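/- Let $\alpha\in[1,2]$, $a>0$, and let $\beta\in[2,\infty]$ be the conjugate exponent, $1/\alpha+1/\beta=1$. For $x\in\mathbb R$ put $$L_{a,\alpha}(x)=\begin{cases}\dfrac{x^2}{2}, & |x|\le a,\\[1ex] a^{2-\alpha}\dfrac{|x|^\alpha}{\alpha}+a^2\dfrac{\alpha-2}{2\alpha}, & |x|> a,\end{cases}$$ $$H_{a,\alpha}(x)=\begin{cases}\dfrac{x^2}{2}, & |x|\le a,\\[1ex] a^{2-\beta}\dfrac{|x|^\beta}{\beta}+a^2\dfrac{\beta-2}{2\beta}, & |x|> a,\ \alpha\neq1,\\[1ex] +\infty, & |x|>a,\ \alpha=1,\end{cases}$$ and for $x\in\mathbb R^n$ put $L_{a,\alpha}(x)=\sum_{i=1}^n L_{a,\alpha}(x_i)$. For a probability measure $\mu$ on $\mathbb R^n$ and a $\mu$-integrable $g\ge0$ let $\mathrm{Ent}_\mu(g)=\int g\log\frac{g}{\int g\,d\mu}\,d\mu\in[0,\infty]$. A probability measure $\mu$ on $\mathbb R^n$ satisfies $LSI_{a,\alpha}(C)$ if for every $C^\infty$ function $f\in L^2(\mu)$, $$\mathrm{Ent}_\mu(f^2)\le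 C\int \sum_{i=1}^n H_{a,\alpha}\Big(\frac{1}{f}\frac{\partial f}{\partial x_i}\Big)f^2\,d\mu,$$ where the integrand is taken to be $+\infty$ at the points where $f=0$ (the convention $0/0=\infty$). It satisfies $T_{a,\alpha}(C)$ if for every probability density $F$ with respect to $\mu$, $$T_{L_{a,\alpha}}(F\,d\mu,\mu)\le C\,\mathrm{Ent}_\mu(F),\qquad T_{L_{a,\alpha}}(F\,d\mu,\mu)=\inf_\pi\int L_{a,\alpha}(x-y)\,d\pi(x,y),$$ the infimum being over all probability measures $\pi$ on $\mathbb R^n\times\mathbb R^n$ with marginals $F\,d\mu$ and $\mu$. Theorem. Let $\alpha\in[1,2]$, $a>0$, $C>0$, and let $\mu$ be a (Borel) probability measure on $\mathbb R^n$ that satisfies $LSI_{a,\alpha}(C)$. Then $\mu$ satisfies $T_{aC/2,\alpha}(C/4)$, that is, for every probability density $F$ with respect to $\mu$, $$T_{L_{aC/2,\alpha}}(F\,d\mu,\mu)\le\frac{C}{4}\,\mathrm{Ent}_\mu(F).$$ -/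

import Mathlib

open MeasureTheory
open scoped ENNReal ContDiff

namespace ModifiedLogSobolev

/-- `ℝⁿ` with its Euclidean structure. -/
abbrev Rn (n : ℕ) : Type := EuclideanSpace ℝ (Fin n)

/-- The function `L_{a,α}` on the real line: `x² / 2` for `|x| ≤ a` and
`a^(2-α) |x|^α / α + a² (α-2) / (2α)` for `|x| > a`.
For `α = 1` the second expression is `a |x| - a² / 2`. -/
noncomputable def costL (a α x : ℝ) : ℝ :=
  if |x| ≤ a then x ^ 2 / 2
  else a ^ (2 - α) * (|x| ^ α / α) + a ^ 2 * ((α - 2) / (2 * α))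

/-- The function `H_{a,α}` on the real line, with values in `[0, ∞]`: `x² / 2` for `|x| ≤ a` and,
for `|x| > a`, `∞` if `α = 1`, and `a^(2-β) |x|^β / β + a² (β-2) / (2β)` if `α ≠ 1`, where
`β = α / (α - 1)` is the conjugate exponent of `α`. -/
noncomputable def energyH (a α x : ℝ) : ℝ≥0∞ :=
  if |x| ≤ a then ENNReal.ofReal (x ^ 2 / 2)
  else if α = 1 then ⊤
  else ENNReal.ofReal
    (a ^ (2 - α.conjExponent) * (|x| ^ α.conjExponent / α.conjExponent)
      + a ^ 2 * ((α.conjExponent - 2) / (2 * α.conjExponent)))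

/-- The cost `L_{a,α}` on `ℝⁿ`: the sum over the coordinates. -/
noncomputable def costLn {n : ℕ} (a α : ℝ) (x : Rn n) : ℝ := ∑ i, costL a α (x i)

/-- The partial derivative of `f` in the `i`-th coordinate. -/
noncomputable def partialDeriv {n : ℕ} (f : Rn n → ℝ) (i : Fin n) (x : Rn n) : ℝ :=
  fderiv ℝ f x (EuclideanSpace.single i 1)

/-- The integrand `H_{a,α}(∇f / f) f²`, with `H_{a,α}(∇f / f) = ∑ i, H_{a,α}(∂ᵢf / f)`.
A quotient with denominator `0` counts as `∞` (also `0 / 0`), and the integrand is then `∞`. -/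
noncomputable def energyDensity {n : ℕ} (a α : ℝ) (f : Rn n → ℝ) (x : Rn n) : ℝ≥0∞ :=
  if f x = 0 then ⊤
  else (∑ i, energyH a α (partialDeriv f i x / f x)) * ENNReal.ofReal (f x ^ 2)

open scoped Classical in
/-- The entropy `Ent_μ(g) = ∫ g log (g / ∫ g dμ) dμ ∈ [0, ∞]` of a nonnegative `μ`-integrable
function `g` under a probability measure `μ`. The negative part of the integrand is bounded, so
the integral is `∞` if the integrand is not integrable, and it is nonnegative otherwise. -/
noncomputable def ent {n : ℕ} (μ : Measure (Rn n)) (g : Rn n → ℝ) : ℝ≥0∞ :=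
  if Integrable (fun x => g x * Real.log (g x / ∫ y, g y ∂μ)) μ then
    ENNReal.ofReal (∫ x, g x * Real.log (g x / ∫ y, g y ∂μ) ∂μ)
  else ⊤

/-- The inequality `LSI_{a,α}(C)`: for every smooth `f` in `L²(μ)`,
`Ent_μ(f²) ≤ C ∫ H_{a,α}(∇f / f) f² dμ`. -/
def LSI {n : ℕ} (μ : Measure (Rn n)) (a α C : ℝ) : Prop :=
  ∀ f : Rn n → ℝ, ContDiff ℝ ∞ f → MemLp f 2 μ →
    ent μ (fun x => f x ^ 2) ≤ ENNReal.ofReal C * ∫⁻ x, energyDensity a α f x ∂μ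

/-- `π` is a coupling of `ν` and `μ`: its two marginals are `ν` and `μ`. -/
def IsCoupling {n : ℕ} (π : Measure (Rn n × Rn n)) (ν μ : Measure (Rn n)) : Prop :=
  π.map Prod.fst = ν ∧ π.map Prod.snd = μ

/-- The transportation cost `T_{L_{a,α}}(ν, μ) = inf_π ∫ L_{a,α}(x - y) dπ(x, y)`, the infimum
being over the probability measures `π` with marginals `ν` and `μ`. -/
noncomputable def transportCost {n : ℕ} (a α : ℝ) (ν μ : Measure (Rn n)) : ℝ≥0∞ :=
  ⨅ (π : Measure (Rn n × Rn n)) (_ : IsProbabilityMeasure π) (_ : IsCoupling π ν μ),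
    ∫⁻ p, ENNReal.ofReal (costLn a α (p.1 - p.2)) ∂π

/-- `F` is a probability density with respect to `μ`. -/
def IsProbDensity {n : ℕ} (μ : Measure (Rn n)) (F : Rn n → ℝ) : Prop :=
  Integrable F μ ∧ 0 ≤ᵐ[μ] F ∧ ∫ x, F x ∂μ = 1

/-- The transportation inequality `T_{a,α}(C)`: for every probability density `F` with respect
to `μ`, `T_{L_{a,α}}(F dμ, μ) ≤ C Ent_μ(F)`. -/
def TransportIneq {n : ℕ} (μ : Measure (Rn n)) (a α C : ℝ) : Prop :=
  ∀ F : Rn n → ℝ, IsProbDensity μ F →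
    transportCost a α (μ.withDensity fun x => ENNReal.ofReal (F x)) μ
      ≤ ENNReal.ofReal C * ent μ F

end ModifiedLogSobolev

/-!
# From a modified logarithmic Sobolev inequality to a transportation inequality

The argument is hypercontractivity along the Hamilton-Jacobi equation. Put `a' = a C / 2`. The
function `H_{a',α}` is the convex conjugate of the cost `L_{a',α}`, so the Hopf-Lax evolution
`Q_t g(x) = inf_w (g (x - t w) + t L_{a',α}(w))` formally solves
`∂ₜ Q_t g + H_{a',α}(∇ Q_t g) = 0`. With `k(t) = 4 t / C`, the derivative of
`(1/k) log ∫ exp (k Q_t g) dμ` is a positive multiple of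
`k' Ent_μ(exp (k Q_t g)) + k² ∫ ∂ₜ Q_t g exp (k Q_t g) dμ`. The logarithmic Sobolev inequality for
`exp (k Q_t g / 2)` together with the scaling bound `H_{a,α}(l y) ≤ l² H_{a',α}(y)` for `l a' ≤ a`
(`sum_energyH_le`, used with `l = k / 2`) makes it nonpositive. Hence
`∫ exp ((4/C) Q_1 g) dμ ≤ exp ((4/C) ∫ g dμ)`, which by the entropy inequality
(`integral_mul_le_entropy_add_log`) is the dual form of the transportation inequality.

Since `μ` is arbitrary, differentiability of `Q_t g` Lebesgue almost everywhere is of no use.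
Only the sub-solution inequality matters, and in its integrated form
`Q_{t+s} g (x + s w) ≤ Q_t g (x) + s L_{a',α}(w)` (`hopfLax_add_le`) it is a consequence of the
convexity of the cost and is preserved by convolution in `(t, x)`. The mollified evolution is
smooth, so that differentiating the inequality along `(1, w)` (`fderiv_le_of_add_le`) gives a
classical sub-solution, to which `LSI` applies (`LSI.log_integral_exp_le`). The mollification is
removed in `LSI.integral_add_integral_le`.

The passage from the dual to the transport cost is Kantorovich duality
(`exists_coupling_of_dual_le`). It is obtained without compactness of the set of couplings: the
Hahn-Banach theorem yields a positive functional on bounded continuous functions with the right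
marginals and controlled cost, the marginals make it tight, and the Riesz-Markov-Kakutani theorem
represents it by a measure.
-/

namespace ModifiedLogSobolev

/-! ### Kantorovich duality -/

section Kantorovich

open Filter Topology
open scoped BoundedContinuousFunction CompactlySupported

/-- A positive normalized linear functional on bounded continuous functions which does not lose
mass along a sequence of compactly supported cutoffs is integration against a probability measure.
-/
theorem exists_probabilityMeasure_of_tight {Z : Type*} [TopologicalSpace Z] [T2Space Z]
    [LocallyCompactSpace Z] [MeasurableSpace Z] [BorelSpace Z] (G : (Z →ᵇ ℝ) →ₗ[ℝ] ℝ)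
    (hpos : ∀ h, (∀ z, 0 ≤ h z) → 0 ≤ G h) (hone : G (BoundedContinuousFunction.const Z 1) = 1)
    (χ : ℕ → C_c(Z, ℝ)) (hχ0 : ∀ k z, 0 ≤ χ k z) (hχ1 : ∀ k z, χ k z ≤ 1)
    (hχ : ∀ z, Tendsto (fun k => χ k z) atTop (𝓝 1))
    (hG : Tendsto (fun k => G (χ k).toBoundedContinuousFunction) atTop (𝓝 1)) :
    ∃ π : Measure Z, IsProbabilityMeasure π ∧ ∀ h : Z →ᵇ ℝ, ∫ z, h z ∂π = G h := by
  have hmono : ∀ h₁ h₂ : Z →ᵇ ℝ, (∀ z, h₁ z ≤ h₂ z) → G h₁ ≤ G h₂ := fun h₁ h₂ h => by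
    have := hpos (h₂ - h₁) fun z => by simpa using h z
    rw [map_sub] at this
    linarith
  let Λ₀ : C_c(Z, ℝ) →ₗ[ℝ] ℝ :=
    { toFun := fun h => G h.toBoundedContinuousFunction
      map_add' := fun h₁ h₂ => by rw [← map_add]; rfl
      map_smul' := fun c h => by rw [RingHom.id_apply, ← map_smul]; rfl }
  let Λ : C_c(Z, ℝ) →ₚ[ℝ] ℝ := PositiveLinearMap.mk₀ Λ₀ fun h hh => hpos _ fun z => hh z
  have hΛ : ∀ h : C_c(Z, ℝ), ∫ z, h z ∂(RealRMK.rieszMeasure Λ) = G h.toBoundedContinuousFunction :=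
    fun h => RealRMK.integral_rieszMeasure Λ h
  set π := RealRMK.rieszMeasure Λ with hπ
  have hint : ∀ h : C_c(Z, ℝ), Integrable (fun z => h z) π := fun h =>
    h.continuous.integrable_of_hasCompactSupport h.hasCompactSupport
  -- the representing measure is finite by Fatou's lemma; that no mass is lost is seen at the end,
  -- from `key` for the constant function
  have huniv : π Set.univ ≤ 1 := by
    have h1 : ∫⁻ z, ENNReal.ofReal 1 ∂π ≤ 1 := by
      have hl : ∀ z, ENNReal.ofReal 1 = liminf (fun k => ENNReal.ofReal (χ k z)) atTop := fun z =>
        ((ENNReal.tendsto_ofReal (hχ z)).liminf_eq).symm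
      calc ∫⁻ z, ENNReal.ofReal 1 ∂π
          = ∫⁻ z, liminf (fun k => ENNReal.ofReal (χ k z)) atTop ∂π := by
            congr 1; ext z; exact hl z
        _ ≤ liminf (fun k => ∫⁻ z, ENNReal.ofReal (χ k z) ∂π) atTop :=
            lintegral_liminf_le fun k => (χ k).continuous.measurable.ennreal_ofReal
        _ = liminf (fun k => ENNReal.ofReal (G (χ k).toBoundedContinuousFunction)) atTop := by
            congr 1; ext k
            rw [← ofReal_integral_eq_lintegral_ofReal (hint _) (ae_of_all _ (hχ0 k)), hΛ]
        _ = ENNReal.ofReal 1 := (ENNReal.tendsto_ofReal hG).liminf_eq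
        _ = 1 := by simp
    simpa using h1
  have : IsFiniteMeasure π := ⟨huniv.trans_lt ENNReal.one_lt_top⟩
  have key : ∀ h : Z →ᵇ ℝ, ∫ z, h z ∂π = G h := fun h => by
    let hk : ℕ → C_c(Z, ℝ) := fun k =>
      ⟨⟨fun z => χ k z * h z, (χ k).continuous.mul h.continuous⟩,
        (χ k).hasCompactSupport.mul_right⟩
    have hkv : ∀ k z, hk k z = χ k z * h z := fun k z => rfl
    have h1 : Tendsto (fun k => ∫ z, hk k z ∂π) atTop (𝓝 (∫ z, h z ∂π)) := by
      refine tendsto_integral_of_dominated_convergence (fun _ => ‖h‖)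
        (fun k => (hk k).continuous.aestronglyMeasurable) (integrable_const _)
        (fun k => ae_of_all _ fun z => ?_) (ae_of_all _ fun z => ?_)
      · rw [hkv, norm_mul]
        have : ‖χ k z‖ ≤ 1 := by rw [Real.norm_of_nonneg (hχ0 k z)]; exact hχ1 k z
        exact (mul_le_mul this (h.norm_coe_le_norm z) (norm_nonneg _) zero_le_one).trans
          (one_mul _).le
      · simpa [hkv] using (hχ z).mul_const (h z)
    have h2 : Tendsto (fun k => ∫ z, hk k z ∂π) atTop (𝓝 (G h)) := by
      simp_rw [hΛ]
      rw [tendsto_iff_norm_sub_tendsto_zero]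
      have hz : Tendsto (fun k => ‖h‖ * (1 - G (χ k).toBoundedContinuousFunction)) atTop (𝓝 0) := by
        simpa using (hG.const_sub 1).const_mul ‖h‖
      refine squeeze_zero (fun _ => norm_nonneg _) (fun k => ?_) hz
      have hE : ‖h‖ * (1 - G (χ k).toBoundedContinuousFunction) =
          G (‖h‖ • (BoundedContinuousFunction.const Z 1 - (χ k).toBoundedContinuousFunction)) := by
        rw [map_smul, map_sub, hone, smul_eq_mul]
      have hb : ∀ z, |(χ k z - 1) * h z| ≤ ‖h‖ * (1 - χ k z) := fun z => by
        rw [abs_mul, abs_of_nonpos (by linarith [hχ1 k z] : χ k z - 1 ≤ 0), mul_comm]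
        have := h.norm_coe_le_norm z
        rw [Real.norm_eq_abs] at this
        nlinarith [hχ1 k z]
      rw [hE, ← map_sub, Real.norm_eq_abs, abs_le, ← map_neg]
      constructor
      · refine hmono _ _ fun z => ?_
        have := (abs_le.1 (hb z)).1
        change -(‖h‖ * (1 - χ k z)) ≤ χ k z * h z - h z
        linarith
      · refine hmono _ _ fun z => ?_
        have := (abs_le.1 (hb z)).2
        change χ k z * h z - h z ≤ ‖h‖ * (1 - χ k z)
        linarith
    exact tendsto_nhds_unique h1 h2
  refine ⟨π, ⟨?_⟩, key⟩
  have := key (BoundedContinuousFunction.const Z 1)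
  rw [hone] at this
  simpa [Measure.real, ENNReal.toReal_eq_one_iff] using this

/-- Continuous compactly supported cutoffs on a proper space, eventually equal to `1` at each point.
-/
theorem exists_cutoff (X : Type*) [PseudoMetricSpace X] [ProperSpace X] [Nonempty X] :
    ∃ η : ℕ → C_c(X, ℝ), (∀ k x, 0 ≤ η k x) ∧ (∀ k x, η k x ≤ 1) ∧
      ∀ x, ∀ᶠ k in atTop, η k x = 1 := by
  obtain ⟨x₀⟩ := ‹Nonempty X›
  refine ⟨fun k => ⟨⟨fun x => max 0 (min 1 (k + 1 - dist x x₀)), by fun_prop⟩, ?_⟩,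
    fun k x => le_max_left _ _, fun k x => max_le zero_le_one (min_le_left _ _), fun x => ?_⟩
  · refine HasCompactSupport.intro (isCompact_closedBall x₀ (k + 1)) fun x hx => ?_
    rw [Metric.mem_closedBall, not_le] at hx
    change max 0 (min 1 ((k : ℝ) + 1 - dist x x₀)) = 0
    exact max_eq_left ((min_le_right _ _).trans (by linarith))
  · obtain ⟨N, hN⟩ := exists_nat_ge (dist x x₀)
    filter_upwards [eventually_ge_atTop N] with k hk
    have : (N : ℝ) ≤ k := by exact_mod_cast hk
    change max 0 (min 1 ((k : ℝ) + 1 - dist x x₀)) = 1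
    rw [min_eq_left (by linarith), max_eq_right zero_le_one]

theorem tendsto_integral_cutoff {W : Type*} [TopologicalSpace W] [MeasurableSpace W]
    [OpensMeasurableSpace W] (ρ : Measure W) [IsProbabilityMeasure ρ] {η : ℕ → C_c(W, ℝ)}
    (h0 : ∀ k x, 0 ≤ η k x) (h1 : ∀ k x, η k x ≤ 1) (h : ∀ x, ∀ᶠ k in atTop, η k x = 1) :
    Tendsto (fun k => ∫ x, η k x ∂ρ) atTop (𝓝 1) := by
  have : (1 : ℝ) = ∫ x, (1 : ℝ) ∂ρ := by simp
  rw [this]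
  refine tendsto_integral_of_dominated_convergence (fun _ => 1)
    (fun k => (η k).continuous.measurable.aestronglyMeasurable) (integrable_const _)
    (fun k => ae_of_all _ fun z => ?_) (ae_of_all _ fun z => ?_)
  · rw [Real.norm_of_nonneg (h0 k z)]; exact h1 k z
  · exact tendsto_const_nhds.congr' ((h z).mono fun k hk => hk.symm)

/-- The hard half of Kantorovich duality: a bound on the dual problem is a bound on the primal one.
The cost may be unbounded, and the bound is reached by an actual coupling. -/
theorem exists_coupling_of_dual_le {X Y : Type*} [MetricSpace X] [ProperSpace X]
    [MeasurableSpace X] [BorelSpace X] [MetricSpace Y] [ProperSpace Y]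
    [MeasurableSpace Y] [BorelSpace Y] (ν : Measure X) (μ : Measure Y) [IsProbabilityMeasure ν]
    [IsProbabilityMeasure μ] (c : X × Y → ℝ) (hc : Continuous c) (hc0 : ∀ p, 0 ≤ c p) (K : ℝ)
    (hK : ∀ (φ : X →ᵇ ℝ) (ψ : Y →ᵇ ℝ), (∀ x y, φ x + ψ y ≤ c (x, y)) →
      ∫ x, φ x ∂ν + ∫ y, ψ y ∂μ ≤ K) :
    ∃ π : Measure (X × Y), IsProbabilityMeasure π ∧ π.map Prod.fst = ν ∧ π.map Prod.snd = μ ∧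
      ∫⁻ p, ENNReal.ofReal (c p) ∂π ≤ ENNReal.ofReal K := by
  have : Nonempty X := nonempty_of_isProbabilityMeasure ν
  have : Nonempty Y := nonempty_of_isProbabilityMeasure μ
  have hK0 : 0 ≤ K := by simpa using hK 0 0 (fun x y => by simpa using hc0 (x, y))
  -- `N h` is the least value at which `h` is dominated by a sum of functions of one variable and a
  -- nonnegative multiple of the cost, priced at `K`; `N h > -∞` is what the dual bound says
  let S : ((X × Y) →ᵇ ℝ) → Set ℝ := fun h =>
    {r | ∃ (φ : X →ᵇ ℝ) (ψ : Y →ᵇ ℝ) (s : ℝ), 0 ≤ s ∧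
      (∀ x y, h (x, y) ≤ φ x + ψ y + s * c (x, y)) ∧ r = ∫ x, φ x ∂ν + ∫ y, ψ y ∂μ + s * K}
  let N : ((X × Y) →ᵇ ℝ) → ℝ := fun h => sInf (S h)
  have hlow : ∀ h (b : ℝ), (∀ p, b ≤ h p) → ∀ r ∈ S h, b ≤ r := by
    rintro h b hb r ⟨φ, ψ, s, hs, hh, rfl⟩
    -- scaling `φ ⊕ ψ` by `1 / s` needs `s > 0`; enlarging `s` reduces to that case
    refine le_of_forall_pos_le_add fun ε hε => ?_
    set t := s + ε / (K + 1) with ht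
    have hK1 : 0 < K + 1 := by linarith
    have htpos : 0 < t := by positivity
    have h1 := hK (t⁻¹ • (BoundedContinuousFunction.const X b - φ)) (t⁻¹ • (-ψ)) fun x y => by
      have h2 : b - φ x - ψ y ≤ t * c (x, y) := by
        have := hh x y
        have := hb (x, y)
        have : s * c (x, y) ≤ t * c (x, y) :=
          mul_le_mul_of_nonneg_right (by rw [ht]; linarith [div_pos hε hK1]) (hc0 _)
        linarith
      change t⁻¹ * (b - φ x) + t⁻¹ * (- ψ y) ≤ c (x, y)
      rw [← mul_add, inv_mul_le_iff₀ htpos]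
      linarith
    have h3 : ∫ x, (t⁻¹ • (BoundedContinuousFunction.const X b - φ)) x ∂ν =
        t⁻¹ * (b - ∫ x, φ x ∂ν) := by
      change ∫ x, t⁻¹ * (b - φ x) ∂ν = _
      rw [integral_const_mul, integral_sub (integrable_const _) (φ.integrable ν)]
      simp
    have h4 : ∫ y, (t⁻¹ • (-ψ)) y ∂μ = t⁻¹ * (- ∫ y, ψ y ∂μ) := by
      change ∫ y, t⁻¹ * (- ψ y) ∂μ = _
      rw [integral_const_mul, integral_neg]
    rw [h3, h4, ← mul_add, inv_mul_le_iff₀ htpos] at h1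
    have h5 : ε / (K + 1) * K ≤ ε := by
      rw [div_mul_eq_mul_div, div_le_iff₀ hK1]; nlinarith
    have h6 : t * K = s * K + ε / (K + 1) * K := by rw [ht]; ring
    linarith
  have hbdd : ∀ h, BddBelow (S h) := fun h =>
    ⟨-‖h‖, fun r hr => hlow h _ (fun p => (abs_le.1 (h.norm_coe_le_norm p)).1) r hr⟩
  have hne : ∀ h, (S h).Nonempty := fun h =>
    ⟨_, BoundedContinuousFunction.const X ‖h‖, 0, 0, le_rfl, fun x y => by
      simpa using (abs_le.1 (h.norm_coe_le_norm (x, y))).2, rfl⟩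
  have N_hom : ∀ a : ℝ, 0 < a → ∀ h, N (a • h) = a * N h := by
    have hle : ∀ a : ℝ, 0 < a → ∀ h, N (a • h) ≤ a * N h := fun a ha h => by
      rw [← inv_mul_le_iff₀ ha]
      refine le_csInf (hne h) ?_
      rintro r ⟨φ, ψ, s, hs, hh, rfl⟩
      rw [inv_mul_le_iff₀ ha]
      refine csInf_le (hbdd _) ⟨a • φ, a • ψ, a * s, by positivity, fun x y => ?_, ?_⟩
      · have := mul_le_mul_of_nonneg_left (hh x y) ha.le
        change a * h (x, y) ≤ a * φ x + a * ψ y + a * s * c (x, y)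
        linarith
      · change _ = ∫ x, a * φ x ∂ν + ∫ y, a * ψ y ∂μ + a * s * K
        rw [integral_const_mul, integral_const_mul]
        ring
    intro a ha h
    refine le_antisymm (hle a ha h) ?_
    have := hle a⁻¹ (inv_pos.2 ha) (a • h)
    rwa [smul_smul, inv_mul_cancel₀ ha.ne', one_smul, ← div_eq_inv_mul, le_div_iff₀ ha,
      mul_comm] at this
  have N_add : ∀ h₁ h₂, N (h₁ + h₂) ≤ N h₁ + N h₂ := fun h₁ h₂ => by
    have : N (h₁ + h₂) - N h₂ ≤ N h₁ := by
      refine le_csInf (hne h₁) ?_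
      rintro r ⟨φ, ψ, s, hs, hh, rfl⟩
      rw [sub_le_comm]
      refine le_csInf (hne h₂) ?_
      rintro r' ⟨φ', ψ', s', hs', hh', rfl⟩
      rw [sub_le_iff_le_add]
      refine csInf_le (hbdd _) ⟨φ + φ', ψ + ψ', s + s', by positivity, fun x y => ?_, ?_⟩
      · have := hh x y
        have := hh' x y
        change h₁ (x, y) + h₂ (x, y) ≤ (φ x + φ' x) + (ψ y + ψ' y) + (s + s') * c (x, y)
        linarith
      · change _ = ∫ x, (φ x + φ' x) ∂ν + ∫ y, (ψ y + ψ' y) ∂μ + (s + s') * K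
        rw [integral_add (φ.integrable ν) (φ'.integrable ν),
          integral_add (ψ.integrable μ) (ψ'.integrable μ)]
        ring
    linarith
  obtain ⟨G, -, hG⟩ := exists_extension_of_le_sublinear (⊥ : ((X × Y) →ᵇ ℝ) →ₗ.[ℝ] ℝ) N N_hom N_add
    (fun x => by
      have hx : (x : (X × Y) →ᵇ ℝ) = 0 := by
        exact (Submodule.mem_bot ℝ).1 x.2
      rw [hx]
      have : (⊥ : ((X × Y) →ᵇ ℝ) →ₗ.[ℝ] ℝ) x = 0 := rfl
      rw [this]
      exact le_csInf (hne 0) (hlow 0 0 fun p => le_rfl))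
  have hGle : ∀ (h : (X × Y) →ᵇ ℝ) (φ : X →ᵇ ℝ) (ψ : Y →ᵇ ℝ) (s : ℝ), 0 ≤ s →
      (∀ x y, h (x, y) ≤ φ x + ψ y + s * c (x, y)) →
      G h ≤ ∫ x, φ x ∂ν + ∫ y, ψ y ∂μ + s * K := fun h φ ψ s hs hh =>
    (hG h).trans (csInf_le (hbdd h) ⟨φ, ψ, s, hs, hh, rfl⟩)
  have hpos : ∀ h : (X × Y) →ᵇ ℝ, (∀ z, 0 ≤ h z) → 0 ≤ G h := fun h hh => by
    have := hGle (-h) 0 0 0 le_rfl fun x y => by simpa using hh (x, y)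
    rw [map_neg] at this
    simpa using this
  have hGeq : ∀ (h : (X × Y) →ᵇ ℝ) (φ : X →ᵇ ℝ) (ψ : Y →ᵇ ℝ), (∀ x y, h (x, y) = φ x + ψ y) →
      G h = ∫ x, φ x ∂ν + ∫ y, ψ y ∂μ := fun h φ ψ hh => by
    refine le_antisymm ?_ ?_
    · simpa using hGle h φ ψ 0 le_rfl fun x y => by simp [hh]
    · have h1 := hGle (-h) (-φ) (-ψ) 0 le_rfl fun x y => by simp [hh]
      have h2 : ∫ x, (-φ) x ∂ν = - ∫ x, φ x ∂ν := integral_neg _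
      have h3 : ∫ x, (-ψ) x ∂μ = - ∫ x, ψ x ∂μ := integral_neg _
      rw [map_neg, h2, h3] at h1
      linarith
  have hone : G (BoundedContinuousFunction.const (X × Y) 1) = 1 := by
    have := hGeq (BoundedContinuousFunction.const (X × Y) 1) (BoundedContinuousFunction.const X 1)
      0 fun x y => by simp
    simpa using this
  -- the mass that `G` places outside a product of large balls is controlled by the marginals
  obtain ⟨ηX, hX0, hX1, hX⟩ := exists_cutoff X
  obtain ⟨ηY, hY0, hY1, hY⟩ := exists_cutoff Y
  let χ : ℕ → C_c(X × Y, ℝ) := fun k =>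
    ⟨⟨fun p => ηX k p.1 * ηY k p.2, ((ηX k).continuous.comp continuous_fst).mul
      ((ηY k).continuous.comp continuous_snd)⟩, by
      refine HasCompactSupport.intro
        ((ηX k).hasCompactSupport.isCompact.prod (ηY k).hasCompactSupport.isCompact) fun p hp => ?_
      by_contra h
      exact hp ⟨subset_tsupport _ (left_ne_zero_of_mul h), subset_tsupport _
        (right_ne_zero_of_mul h)⟩⟩
  have hχv : ∀ k p, χ k p = ηX k p.1 * ηY k p.2 := fun k p => rfl
  have hGχ : Tendsto (fun k => G (χ k).toBoundedContinuousFunction) atTop (𝓝 1) := by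
    have hl : Tendsto (fun k => ∫ x, ηX k x ∂ν + ∫ y, ηY k y ∂μ - 1) atTop (𝓝 1) := by
      have := ((tendsto_integral_cutoff ν hX0 hX1 hX).add
        (tendsto_integral_cutoff μ hY0 hY1 hY)).sub_const 1
      norm_num at this
      exact this
    refine tendsto_of_tendsto_of_tendsto_of_le_of_le hl tendsto_const_nhds (fun k => ?_)
      (fun k => ?_)
    · have h1 := hGle (-(χ k).toBoundedContinuousFunction)
        (-(ηX k).toBoundedContinuousFunction)
        (BoundedContinuousFunction.const Y 1 - (ηY k).toBoundedContinuousFunction) 0 le_rfl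
        fun x y => by
          change -(ηX k x * ηY k y) ≤ -(ηX k x) + (1 - ηY k y) + 0 * c (x, y)
          nlinarith [hX0 k x, hX1 k x, hY0 k y, hY1 k y]
      have h2 : ∫ x, (-(ηX k).toBoundedContinuousFunction) x ∂ν = - ∫ x, ηX k x ∂ν :=
        integral_neg _
      have h3 : ∫ y, (BoundedContinuousFunction.const Y (1 : ℝ) -
          (ηY k).toBoundedContinuousFunction : Y →ᵇ ℝ) y ∂μ = 1 - ∫ y, ηY k y ∂μ := by
        change ∫ y, (1 - ηY k y) ∂μ = _
        have hi : Integrable (fun y => ηY k y) μ :=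
          (ηY k).toBoundedContinuousFunction.integrable μ
        rw [integral_sub (integrable_const _) hi]
        simp
      rw [map_neg, h2, h3] at h1
      linarith
    · rw [← hone]
      have := hpos (BoundedContinuousFunction.const (X × Y) 1 -
        (χ k).toBoundedContinuousFunction) fun p => by
          change 0 ≤ 1 - ηX k p.1 * ηY k p.2
          nlinarith [hX0 k p.1, hX1 k p.1, hY0 k p.2, hY1 k p.2]
      rw [map_sub] at this
      linarith
  obtain ⟨π, hπ, hπG⟩ := exists_probabilityMeasure_of_tight G hpos hone χ
    (fun k p => mul_nonneg (hX0 k p.1) (hY0 k p.2))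
    (fun k p => mul_le_one₀ (hX1 k p.1) (hY0 k p.2) (hY1 k p.2))
    (fun p => by
      refine tendsto_const_nhds.congr' ?_
      filter_upwards [hX p.1, hY p.2] with k h1 h2
      rw [hχv, h1, h2, one_mul]) hGχ
  refine ⟨π, hπ, ?_, ?_, ?_⟩
  · have := Measure.isProbabilityMeasure_map (μ := π) measurable_fst.aemeasurable
    refine ext_of_forall_integral_eq_of_IsFiniteMeasure fun φ => ?_
    rw [integral_map measurable_fst.aemeasurable φ.continuous.measurable.aestronglyMeasurable]
    have := hGeq (φ.compContinuous ⟨Prod.fst, continuous_fst⟩) φ 0 fun x y => by simp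
    rw [← hπG] at this
    simpa using this
  · have := Measure.isProbabilityMeasure_map (μ := π) measurable_snd.aemeasurable
    refine ext_of_forall_integral_eq_of_IsFiniteMeasure fun φ => ?_
    rw [integral_map measurable_snd.aemeasurable φ.continuous.measurable.aestronglyMeasurable]
    have := hGeq (φ.compContinuous ⟨Prod.snd, continuous_snd⟩) 0 φ fun x y => by simp
    rw [← hπG] at this
    simpa using this
  · -- the functional controls the truncations of the cost, and Fatou's lemma the cost itself
    let ck : ℕ → ((X × Y) →ᵇ ℝ) := fun k =>
      BoundedContinuousFunction.ofNormedAddCommGroup (fun p => min (c p) k) (by fun_prop) k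
        fun p => by
          rw [Real.norm_of_nonneg (le_min (hc0 p) (Nat.cast_nonneg k))]; exact min_le_right _ _
    have hck : ∀ k p, ck k p = min (c p) k := fun k p => rfl
    have hck0 : ∀ k p, 0 ≤ ck k p := fun k p => le_min (hc0 p) (Nat.cast_nonneg k)
    have hev : ∀ p, Tendsto (fun k => ENNReal.ofReal (ck k p)) atTop (𝓝 (ENNReal.ofReal (c p))) :=
      fun p => by
        obtain ⟨M, hM⟩ := exists_nat_ge (c p)
        refine tendsto_const_nhds.congr' ?_
        filter_upwards [eventually_ge_atTop M] with k hk
        have : (M : ℝ) ≤ k := by exact_mod_cast hk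
        rw [hck, min_eq_left (hM.trans this)]
    calc ∫⁻ p, ENNReal.ofReal (c p) ∂π
        = ∫⁻ p, liminf (fun k => ENNReal.ofReal (ck k p)) atTop ∂π := by
          congr 1; ext p; exact (hev p).liminf_eq.symm
      _ ≤ liminf (fun k => ∫⁻ p, ENNReal.ofReal (ck k p) ∂π) atTop :=
          lintegral_liminf_le fun k => (ck k).continuous.measurable.ennreal_ofReal
      _ ≤ liminf (fun _ : ℕ => ENNReal.ofReal K) atTop := by
          refine liminf_le_liminf (Eventually.of_forall fun k => ?_)
          rw [← ofReal_integral_eq_lintegral_ofReal ((ck k).integrable π)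
            (ae_of_all _ (hck0 k)), hπG]
          refine ENNReal.ofReal_le_ofReal ?_
          simpa using hGle (ck k) 0 0 1 zero_le_one fun x y => by
            simp [hck]
      _ = ENNReal.ofReal K := by simp

end Kantorovich

/-! ### The cost and the energy on the real line -/

section ScalarCost

variable {a α : ℝ}

theorem costL_of_abs_le {x : ℝ} (hx : |x| ≤ a) : costL a α x = x ^ 2 / 2 := if_pos hx

/-- The outer branch of the cost in the scale-free variable `|x| / a`. The two branches agree for
`|x| = a`, so the formula also holds there. -/
theorem costL_of_le_abs (ha : 0 < a) (hα : α ∈ Set.Icc (1 : ℝ) 2) {x : ℝ} (hx : a ≤ |x|) :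
    costL a α x = a ^ 2 * ((|x| / a) ^ α / α + (α - 2) / (2 * α)) := by
  have hα0 : α ≠ 0 := by linarith [hα.1]
  rcases hx.eq_or_lt with h | h
  · rw [costL_of_abs_le h.ge, ← h, div_self ha.ne', Real.one_rpow, ← sq_abs, ← h]
    field_simp
    ring
  · rw [costL, if_neg h.not_ge, Real.div_rpow (abs_nonneg x) ha.le, Real.rpow_sub ha,
      Real.rpow_two]
    have : a ^ α ≠ 0 := (Real.rpow_pos_of_pos ha α).ne'
    field_simp

theorem costL_abs (x : ℝ) : costL a α |x| = costL a α x := by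
  simp only [costL, abs_abs, sq_abs]

theorem costL_neg (x : ℝ) : costL a α (-x) = costL a α x := by
  rw [← costL_abs, abs_neg, costL_abs]

theorem costL_zero (ha : 0 < a) : costL a α 0 = 0 := by
  rw [costL_of_abs_le (by simpa using ha.le)]
  norm_num

/-- Simultaneous scaling of the threshold and of the variable. -/
theorem costL_mul {s : ℝ} (hs : 0 < s) (ha : 0 < a) (hα : α ∈ Set.Icc (1 : ℝ) 2) (x : ℝ) :
    costL (s * a) α (s * x) = s ^ 2 * costL a α x := by
  have hsx : |s * x| = s * |x| := by rw [abs_mul, abs_of_pos hs]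
  rcases le_total |x| a with h | h
  · rw [costL_of_abs_le h, costL_of_abs_le (by rw [hsx]; gcongr)]
    ring
  · rw [costL_of_le_abs ha hα h, costL_of_le_abs (mul_pos hs ha) hα (by rw [hsx]; gcongr), hsx,
      mul_div_mul_left _ _ hs.ne']
    ring

/-- Young's inequality in the form "the graph of `x ^ α / α` lies above its tangent at `w`". -/
theorem rpow_div_add_mul_sub_le (hα : 1 ≤ α) {x w : ℝ} (hx : 0 ≤ x) (hw : 0 < w) :
    w ^ α / α + w ^ (α - 1) * (x - w) ≤ x ^ α / α := by
  have hα0 : 0 < α := by linarith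
  have h := Real.geom_mean_le_arith_mean2_weighted (w₁ := 1 / α) (w₂ := (α - 1) / α)
    (p₁ := x ^ α) (p₂ := w ^ α) (by positivity) (div_nonneg (by linarith) hα0.le)
    (by positivity) (by positivity) (by field_simp; ring)
  rw [← Real.rpow_mul hx, ← Real.rpow_mul hw.le, mul_one_div_cancel hα0.ne', Real.rpow_one,
    mul_div_cancel₀ _ hα0.ne'] at h
  have h2 : w ^ (α - 1) * w = w ^ α := by
    rw [← Real.rpow_add_one hw.ne', sub_add_cancel]
  have h3 : 1 / α * x ^ α + (α - 1) / α * w ^ α = x ^ α / α + w ^ α - w ^ α / α := by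
    field_simp
    ring
  rw [mul_sub, h2]
  linarith

/-- The cost has a supporting line at each point. -/
theorem exists_support_costL (ha : 0 < a) (hα : α ∈ Set.Icc (1 : ℝ) 2) (w : ℝ) :
    ∃ m : ℝ, ∀ x, costL a α w + m * (x - w) ≤ costL a α x := by
  -- by symmetry it is enough to treat `w, x ≥ 0`
  suffices H : ∀ w : ℝ, 0 ≤ w → ∃ m : ℝ, 0 ≤ m ∧
      ∀ x, 0 ≤ x → costL a α w + m * (x - w) ≤ costL a α x by
    obtain ⟨m, hm, h⟩ := H |w| (abs_nonneg w)
    rcases le_total 0 w with hw | hw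
    · refine ⟨m, fun x => ?_⟩
      have := h |x| (abs_nonneg x)
      rw [costL_abs, costL_abs, abs_of_nonneg hw] at this
      nlinarith [mul_le_mul_of_nonneg_left (le_abs_self x) hm]
    · refine ⟨-m, fun x => ?_⟩
      have := h |x| (abs_nonneg x)
      rw [costL_abs, costL_abs, abs_of_nonpos hw] at this
      nlinarith [mul_le_mul_of_nonneg_left (neg_abs_le x) hm]
  intro w hw
  have hform : ∀ x, a ≤ x → costL a α x = a ^ 2 * ((x / a) ^ α / α + (α - 2) / (2 * α)) :=
    fun x hx => by
      have hx0 : |x| = x := abs_of_nonneg (ha.le.trans hx)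
      rw [costL_of_le_abs ha hα (hx0.symm ▸ hx), hx0]
  have hin : ∀ x, 0 ≤ x → x ≤ a → costL a α x = x ^ 2 / 2 := fun x h0 h =>
    costL_of_abs_le (by rwa [abs_of_nonneg h0])
  -- the tangent of the outer branch at `v ≥ a` stays below that branch
  have htan : ∀ v x, a ≤ v → a ≤ x →
      costL a α v + a * (v / a) ^ (α - 1) * (x - v) ≤ costL a α x := fun v x hv hx => by
    rw [hform v hv, hform x hx]
    have := rpow_div_add_mul_sub_le hα.1 (div_nonneg (ha.le.trans hx) ha.le)
      (div_pos (ha.trans_le hv) ha)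
    have h2 := mul_le_mul_of_nonneg_left this (sq_nonneg a)
    have h3 : a ^ 2 * ((v / a) ^ (α - 1) * (x / a - v / a)) =
        a * (v / a) ^ (α - 1) * (x - v) := by
      field_simp
    linarith
  have htan_a : ∀ x, a ≤ x → a ^ 2 / 2 + a * (x - a) ≤ costL a α x := fun x hx => by
    have := htan a x le_rfl hx
    rwa [div_self ha.ne', Real.one_rpow, mul_one, hin a ha.le le_rfl] at this
  rcases le_or_gt w a with hwa | hwa
  · refine ⟨w, hw, fun x hx => ?_⟩
    rw [hin w hw hwa]
    rcases le_total x a with hxa | hxa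
    · rw [hin x hx hxa]
      nlinarith [sq_nonneg (x - w)]
    · refine le_trans ?_ (htan_a x hxa)
      nlinarith [mul_nonneg (sub_nonneg.2 hwa) (sub_nonneg.2 hxa), sq_nonneg (a - w)]
  · have hm : a ≤ a * (w / a) ^ (α - 1) :=
      le_mul_of_one_le_right ha.le
        (Real.one_le_rpow ((one_le_div ha).2 hwa.le) (by linarith [hα.1]))
    refine ⟨a * (w / a) ^ (α - 1), ha.le.trans hm, fun x hx => ?_⟩
    rcases le_total x a with hxa | hxa
    · have h1 := htan w a hwa.le le_rfl
      rw [hin a ha.le le_rfl] at h1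
      rw [hin x hx hxa]
      nlinarith [mul_nonneg (sub_nonneg.2 hm) (sub_nonneg.2 hxa), sq_nonneg (x - a)]
    · exact htan w x hwa.le hxa

theorem convexOn_costL (ha : 0 < a) (hα : α ∈ Set.Icc (1 : ℝ) 2) :
    ConvexOn ℝ Set.univ (costL a α) := by
  refine ⟨convex_univ, fun x _ y _ p q hp hq hpq => ?_⟩
  obtain ⟨m, hm⟩ := exists_support_costL ha hα (p • x + q • y)
  have h1 := mul_le_mul_of_nonneg_left (hm x) hp
  have h2 := mul_le_mul_of_nonneg_left (hm y) hq
  simp only [smul_eq_mul] at *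
  obtain rfl : q = 1 - p := by linarith
  nlinarith

theorem costL_nonneg (ha : 0 < a) (hα : α ∈ Set.Icc (1 : ℝ) 2) (x : ℝ) : 0 ≤ costL a α x := by
  -- a convex even function is minimal at the origin
  have h := (convexOn_costL ha hα).2 (Set.mem_univ x) (Set.mem_univ (-x))
    (by norm_num : (0 : ℝ) ≤ 1 / 2) (by norm_num : (0 : ℝ) ≤ 1 / 2) (by norm_num)
  rw [costL_neg, smul_neg, add_neg_cancel, costL_zero ha] at h
  simp only [smul_eq_mul] at h
  linarith

theorem continuous_costL (ha : 0 < a) (hα : α ∈ Set.Icc (1 : ℝ) 2) : Continuous (costL a α) :=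
  continuousOn_univ.1 ((convexOn_costL ha hα).continuousOn isOpen_univ)

/-- The cost increases with the threshold: the branches are compared by the weighted
arithmetic-geometric mean inequality. -/
theorem costL_mono {b : ℝ} (ha : 0 < a) (hab : a ≤ b) (hα : α ∈ Set.Icc (1 : ℝ) 2) (x : ℝ) :
    costL a α x ≤ costL b α x := by
  rw [← costL_abs, ← costL_abs (a := b)]
  obtain ⟨z, hz⟩ : ∃ z, z = |x| := ⟨_, rfl⟩
  have hz0 : 0 ≤ z := hz ▸ abs_nonneg x
  rw [← hz]
  clear hz x
  have hb : 0 < b := ha.trans_le hab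
  have hα0 : 0 < α := by linarith [hα.1]
  have hout : ∀ {r : ℝ}, 0 < r → r < z → costL r α z =
      r ^ (2 - α) * z ^ α / α + r ^ 2 * ((α - 2) / (2 * α)) := fun {r} hr h => by
    rw [costL, abs_of_nonneg hz0, if_neg h.not_ge, mul_div_assoc]
  have amgm : ∀ y : ℝ, 0 ≤ y → a ^ (2 - α) * y ^ α ≤ (2 - α) / 2 * a ^ 2 + α / 2 * y ^ 2 :=
    fun y hy => by
      have h := Real.geom_mean_le_arith_mean2_weighted (w₁ := (2 - α) / 2) (w₂ := α / 2)
        (p₁ := a ^ 2) (p₂ := y ^ 2) (by linarith [hα.2]) (by positivity)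
        (by positivity) (by positivity) (by ring)
      rwa [← Real.rpow_natCast_mul ha.le, ← Real.rpow_natCast_mul hy,
        show ((2 : ℕ) : ℝ) * ((2 - α) / 2) = 2 - α by push_cast; ring,
        show ((2 : ℕ) : ℝ) * (α / 2) = α by push_cast; ring] at h
  have hconst : ∀ r : ℝ, r ^ 2 * ((α - 2) / (2 * α)) = -((2 - α) / 2 * r ^ 2) / α := fun r => by
    field_simp; ring
  rcases le_or_gt z a with h | h
  · rw [costL_of_abs_le (by rwa [abs_of_nonneg hz0]),
      costL_of_abs_le (by rw [abs_of_nonneg hz0]; exact h.trans hab)]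
  rcases le_or_gt z b with h' | h'
  · rw [hout ha h, costL_of_abs_le (by rwa [abs_of_nonneg hz0]), hconst, ← add_div,
      div_le_iff₀ hα0]
    linarith [amgm z hz0]
  · rw [hout ha h, hout hb h', hconst, hconst, ← add_div, ← add_div]
    gcongr ?_ / _
    have h1 : (b ^ (2 - α) - a ^ (2 - α)) * b ^ α ≤ (b ^ (2 - α) - a ^ (2 - α)) * z ^ α := by
      refine mul_le_mul_of_nonneg_left (Real.rpow_le_rpow hb.le h'.le hα0.le) (sub_nonneg.2 ?_)
      exact Real.rpow_le_rpow ha.le hab (by linarith [hα.2])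
    have h2 : b ^ (2 - α) * b ^ α = b ^ 2 := by
      rw [← Real.rpow_add hb, sub_add_cancel, Real.rpow_two]
    have h3 := amgm b hb.le
    nlinarith

theorem costL_one_le {x : ℝ} (ha : 0 < a) (hx : 0 ≤ x) : costL a 1 x ≤ a * x := by
  rcases le_or_gt x a with h | h
  · rw [costL_of_abs_le (by rwa [abs_of_nonneg hx])]
    nlinarith
  · rw [costL, abs_of_nonneg hx, if_neg h.not_ge]
    norm_num
    nlinarith [sq_nonneg a]

/-- Where the energy is finite, it is a value `w y - L(w)` of the Legendre transform of the cost.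
The point `w` is the solution of `L'(w) = y`. -/
theorem exists_energyH_eq (ha : 0 < a) (hα : α ∈ Set.Icc (1 : ℝ) 2) {y : ℝ}
    (hy : α = 1 → |y| ≤ a) :
    ∃ w : ℝ, 0 ≤ w * y - costL a α w ∧
      energyH a α y = ENNReal.ofReal (w * y - costL a α w) := by
  rcases le_or_gt |y| a with h | h
  · refine ⟨y, ?_, ?_⟩
    · rw [costL_of_abs_le h]
      nlinarith [sq_nonneg y]
    · rw [energyH, if_pos h, costL_of_abs_le h]
      congr 1
      ring
  have hα1 : α ≠ 1 := fun h1 => absurd (hy h1) h.not_ge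
  have hα' : 1 < α := lt_of_le_of_ne hα.1 (Ne.symm hα1)
  have hα0 : 0 < α - 1 := by linarith
  have hy0 : 0 < |y| := ha.trans h
  obtain ⟨β, hβ⟩ : ∃ β, β = α.conjExponent := ⟨_, rfl⟩
  have hβα : β = α / (α - 1) := hβ
  have hβ2 : 2 ≤ β := by rw [hβα, le_div_iff₀ hα0]; linarith [hα.2]
  have hr1 : 1 < |y| / a := (one_lt_div ha).2 h
  have hr0 : 0 < |y| / a := by positivity
  set r := |y| / a with hr
  have hyr : |y| = a * r := by rw [hr]; field_simp
  have hsy : SignType.sign y * y = |y| := sign_mul_self y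
  have hy_ne : y ≠ 0 := abs_pos.1 hy0
  have habs : |(SignType.sign y : ℝ) * (a * r ^ (β - 1))| = a * r ^ (β - 1) := by
    rw [abs_mul, abs_of_pos (by positivity : 0 < a * r ^ (β - 1))]
    rcases lt_or_gt_of_ne hy_ne with hlt | hlt <;> simp [hlt]
  have hge : a ≤ a * r ^ (β - 1) :=
    le_mul_of_one_le_right ha.le (Real.one_le_rpow hr1.le (by linarith))
  have hcost : costL a α (SignType.sign y * (a * r ^ (β - 1))) =
      a ^ 2 * (r ^ β / α + (α - 2) / (2 * α)) := by
    rw [costL_of_le_abs ha hα (habs.symm ▸ hge), habs, mul_div_cancel_left₀ _ ha.ne',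
      ← Real.rpow_mul hr0.le]
    congr 4
    rw [hβα]; field_simp; ring
  have hprod : (SignType.sign y * (a * r ^ (β - 1))) * y = a ^ 2 * r ^ β := by
    rw [mul_right_comm, hsy, hyr,
      show a * r * (a * r ^ (β - 1)) = a ^ 2 * (r ^ (β - 1) * r) by ring,
      ← Real.rpow_add_one hr0.ne', sub_add_cancel]
  have hval : (SignType.sign y * (a * r ^ (β - 1))) * y - costL a α (SignType.sign y *
      (a * r ^ (β - 1))) = a ^ 2 * (r ^ β / β + (β - 2) / (2 * β)) := by
    rw [hprod, hcost, hβα]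
    field_simp
    ring
  refine ⟨SignType.sign y * (a * r ^ (β - 1)), ?_, ?_⟩
  · rw [hval]
    have : 0 ≤ (β - 2) / (2 * β) := div_nonneg (by linarith) (by linarith)
    have : 0 ≤ r ^ β / β := div_nonneg (by positivity) (by linarith)
    positivity
  · rw [hval, energyH, if_neg h.not_ge, if_neg hα1, ← hβ]
    congr 1
    rw [hyr, Real.mul_rpow ha.le hr0.le, Real.rpow_sub ha, Real.rpow_two]
    have : a ^ β ≠ 0 := (Real.rpow_pos_of_pos ha β).ne'
    field_simp

/-- A vector `y` whose pairing with every `w` is controlled by the cost of `w` has small energy. It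
turns the sub-solution inequality of the Hamilton-Jacobi equation, in which the test direction `w`
is free, into a bound on the energy density. -/
theorem sum_energyH_le {n : ℕ} {a' l m : ℝ} (ha : 0 < a) (ha' : 0 < a')
    (hα : α ∈ Set.Icc (1 : ℝ) 2) (hl : 0 < l) (hla : l * a' ≤ a) (y : Fin n → ℝ)
    (h : ∀ w : Fin n → ℝ, ∑ i, w i * y i ≤ m + ∑ i, costL a' α (w i)) :
    ∑ i, energyH a α (l * y i) ≤ ENNReal.ofReal (l ^ 2 * m) := by
  -- for `α = 1` the linear growth of the cost confines `y` to the region of finite energy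
  have hy : ∀ i, α = 1 → |l * y i| ≤ a := by
    rintro i rfl
    have hbound : ∀ R : ℝ, 0 ≤ R → R * |y i| ≤ m + a' * R := fun R hR => by
      have h1 := h (Pi.single i (R * SignType.sign (y i)))
      have h2 : ∑ j, Pi.single (M := fun _ => ℝ) i (R * (SignType.sign (y i) : ℝ)) j * y j =
          R * |y i| := by
        rw [Finset.sum_eq_single i]
        · rw [Pi.single_eq_same, mul_assoc, sign_mul_self]
        · intro j _ hj; simp [Pi.single_eq_of_ne hj]
        · simp
      have h3 : ∑ j, costL a' 1 (Pi.single (M := fun _ => ℝ) i (R * (SignType.sign (y i) : ℝ)) j) =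
          costL a' 1 (R * SignType.sign (y i)) := by
        rw [Finset.sum_eq_single i]
        · rw [Pi.single_eq_same]
        · intro j _ hj; rw [Pi.single_eq_of_ne hj, costL_zero ha']
        · simp
      have h4 : costL a' 1 (R * SignType.sign (y i)) ≤ a' * R := by
        rw [← costL_abs]
        refine (costL_one_le ha' (abs_nonneg _)).trans ?_
        rw [abs_mul, abs_of_nonneg hR]
        have : |((SignType.sign (y i) : ℝ))| ≤ 1 := by
          rcases lt_trichotomy (y i) 0 with hlt | hlt | hlt <;> simp [hlt]
        nlinarith [mul_nonneg ha'.le hR]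
      rw [h2, h3] at h1
      linarith
    have hle : |y i| ≤ a' := by
      by_contra! hlt
      have hd : 0 < |y i| - a' := by linarith
      have := hbound ((|m| + 1) / (|y i| - a')) (by positivity)
      have h5 : (|m| + 1) / (|y i| - a') * (|y i| - a') = |m| + 1 := by field_simp
      nlinarith [le_abs_self m]
    rw [abs_mul, abs_of_pos hl]
    exact (mul_le_mul_of_nonneg_left hle hl.le).trans hla
  choose w hw0 hw using fun i => exists_energyH_eq ha hα (hy i)
  simp_rw [hw]
  rw [← ENNReal.ofReal_sum_of_nonneg fun i _ => hw0 i]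
  refine ENNReal.ofReal_le_ofReal ?_
  have h1 := mul_le_mul_of_nonneg_left (h fun i => w i / l) (sq_nonneg l)
  have h2 : ∀ i, l ^ 2 * costL a' α (w i / l) ≤ costL a α (w i) := fun i => by
    rw [← costL_mul hl ha' hα, mul_div_cancel₀ _ hl.ne']
    exact costL_mono (mul_pos hl ha') hla hα _
  have h3 := Finset.sum_le_sum fun i (_ : i ∈ Finset.univ) => h2 i
  rw [← Finset.mul_sum] at h3
  have h4 : l ^ 2 * ∑ i, w i / l * y i = ∑ i, w i * (l * y i) := by
    rw [Finset.mul_sum]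
    refine Finset.sum_congr rfl fun i _ => ?_
    field_simp
  rw [Finset.sum_sub_distrib]
  linarith

end ScalarCost

/-! ### The cost on the whole space -/

section CostOnSpace

variable {n : ℕ} {a α : ℝ}

theorem costLn_nonneg (ha : 0 < a) (hα : α ∈ Set.Icc (1 : ℝ) 2) (x : Rn n) :
    0 ≤ costLn a α x :=
  Finset.sum_nonneg fun _ _ => costL_nonneg ha hα _

theorem costLn_zero (ha : 0 < a) : costLn a α (0 : Rn n) = 0 := by
  simp [costLn, costL_zero ha]

theorem continuous_costLn (ha : 0 < a) (hα : α ∈ Set.Icc (1 : ℝ) 2) :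
    Continuous (costLn (n := n) a α) :=
  continuous_finsetSum _ fun i _ => (continuous_costL ha hα).comp (by fun_prop)

theorem convexOn_costLn (ha : 0 < a) (hα : α ∈ Set.Icc (1 : ℝ) 2) :
    ConvexOn ℝ Set.univ (costLn (n := n) a α) := by
  refine ⟨convex_univ, fun x _ y _ p q hp hq hpq => ?_⟩
  simp only [costLn, Finset.smul_sum, ← Finset.sum_add_distrib]
  exact Finset.sum_le_sum fun i _ =>
    (convexOn_costL ha hα).2 (Set.mem_univ (x i)) (Set.mem_univ (y i)) hp hq hpq

end CostOnSpace

/-! ### Mollification of bounded measurable functions -/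

section Mollification

open Filter Topology ContinuousLinearMap
open scoped Convolution

theorem locallyIntegrable_of_bdd {X : Type*} [TopologicalSpace X] [MeasurableSpace X]
    (ρ : Measure X) [IsLocallyFiniteMeasure ρ] {g : X → ℝ} {M : ℝ} (hg : Measurable g)
    (hM : ∀ p, |g p| ≤ M) : LocallyIntegrable g ρ :=
  (locallyIntegrable_const M).mono hg.aestronglyMeasurable
    (ae_of_all _ fun p => by
      rw [Real.norm_eq_abs]; exact (hM p).trans (le_abs_self M))

variable {G : Type*} [NormedAddCommGroup G] [NormedSpace ℝ G] [FiniteDimensional ℝ G]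
  [MeasurableSpace G] [BorelSpace G]

/-- The mollification of `g` by a bump function of integral one. -/
noncomputable def mollify (ρ : Measure G) (φ : ContDiffBump (0 : G)) (g : G → ℝ) (p : G) : ℝ :=
  ∫ q, φ.normed ρ q * g (p - q) ∂ρ

variable (ρ : Measure G) [ρ.IsAddHaarMeasure] (φ : ContDiffBump (0 : G)) {g h : G → ℝ} {M : ℝ}

theorem integrable_mollify (hg : Measurable g) (hM : ∀ p, |g p| ≤ M) (p : G) :
    Integrable (fun q => φ.normed ρ q * g (p - q)) ρ :=
  φ.integrable_normed.mul_bdd (c := M) (hg.comp (measurable_const_sub p)).aestronglyMeasurable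
    (ae_of_all _ fun _ => hM _)

/-- Inequalities that hold along the support of the bump function pass to mollifications. -/
theorem mollify_le_mollify_add (hg : Measurable g) (hgM : ∀ p, |g p| ≤ M) (hh : Measurable h)
    (hhM : ∀ p, |h p| ≤ M) {p p' : G} {c : ℝ}
    (hle : ∀ q, ‖q‖ < φ.rOut → g (p - q) ≤ h (p' - q) + c) :
    mollify ρ φ g p ≤ mollify ρ φ h p' + c := by
  have hc : ∫ q, φ.normed ρ q * c ∂ρ = c := by
    rw [integral_mul_const, φ.integral_normed, one_mul]
  rw [mollify, mollify, ← hc,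
    ← integral_add (integrable_mollify ρ φ hh hhM p') (φ.integrable_normed.mul_const c)]
  refine integral_mono (integrable_mollify ρ φ hg hgM p)
    ((integrable_mollify ρ φ hh hhM p').add (φ.integrable_normed.mul_const c)) fun q => ?_
  by_cases hq : ‖q‖ < φ.rOut
  · have := mul_le_mul_of_nonneg_left (hle q hq) (φ.nonneg_normed (μ := ρ) q)
    change φ.normed ρ q * g (p - q) ≤ φ.normed ρ q * h (p' - q) + φ.normed ρ q * c
    linarith
  · have : φ.normed ρ q = 0 := by
      by_contra h0
      have : q ∈ Function.support (φ.normed ρ) := h0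
      rw [φ.support_normed_eq] at this
      exact hq (by simpa using this)
    simp [this]

theorem abs_mollify_le (hM : ∀ p, |g p| ≤ M) (p : G) : |mollify ρ φ g p| ≤ M := by
  have h := norm_integral_le_of_norm_le (f := fun q => φ.normed ρ q * g (p - q))
    (φ.integrable_normed.mul_const M) (ae_of_all ρ fun q => by
      rw [norm_mul, Real.norm_of_nonneg (φ.nonneg_normed q)]
      exact mul_le_mul_of_nonneg_left (hM _) (φ.nonneg_normed q))
  rwa [integral_mul_const, φ.integral_normed, one_mul] at h

theorem contDiff_mollify (hg : Measurable g) (hM : ∀ p, |g p| ≤ M) :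
    ContDiff ℝ ∞ (mollify ρ φ g) :=
  φ.hasCompactSupport_normed.contDiff_convolution_left (lsmul ℝ ℝ) φ.contDiff_normed
    (locallyIntegrable_of_bdd ρ hg hM)

theorem exists_norm_fderiv_mollify_le (hg : Measurable g) (hM : ∀ p, |g p| ≤ M) :
    ∃ K, ∀ p, ‖fderiv ℝ (mollify ρ φ g) p‖ ≤ K := by
  have hη : ContDiff ℝ 1 (φ.normed ρ) := φ.contDiff_normed
  have hcs : HasCompactSupport (φ.normed ρ) := φ.hasCompactSupport_normed
  refine ⟨∫ q, ‖fderiv ℝ (φ.normed ρ) q‖ * M ∂ρ, fun p => ?_⟩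
  have hd := hcs.hasFDerivAt_convolution_left (lsmul ℝ ℝ : ℝ →L[ℝ] ℝ →L[ℝ] ℝ) hη
    (locallyIntegrable_of_bdd ρ hg hM) p
  rw [show mollify ρ φ g = (φ.normed ρ ⋆[lsmul ℝ ℝ, ρ] g : G → ℝ) from rfl, hd.fderiv]
  have hi : Integrable (fderiv ℝ (φ.normed ρ)) ρ :=
    (hη.continuous_fderiv one_ne_zero).integrable_of_hasCompactSupport (hcs.fderiv ℝ)
  refine norm_integral_le_of_norm_le (hi.norm.mul_const M) (ae_of_all _ fun q => ?_)
  have h1 : (lsmul ℝ ℝ : ℝ →L[ℝ] ℝ →L[ℝ] ℝ).precompL G (fderiv ℝ (φ.normed ρ) q) (g (p - q)) =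
      g (p - q) • fderiv ℝ (φ.normed ρ) q := by
    ext v
    simp [mul_comm]
  rw [h1, norm_smul, mul_comm]
  exact mul_le_mul_of_nonneg_left (hM _) (norm_nonneg _)

theorem tendsto_mollify {ι : Type*} {l : Filter ι} {φ : ι → ContDiffBump (0 : G)}
    (hφ : Tendsto (fun i => (φ i).rOut) l (𝓝 0)) (hg : Continuous g) (p : G) :
    Tendsto (fun i => mollify ρ (φ i) g p) l (𝓝 (g p)) :=
  ContDiffBump.convolution_tendsto_right_of_continuous hφ hg p

end Mollification

/-! ### Hopf-Lax evolution and the Hamilton-Jacobi inequality -/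

section HopfLax

open Filter Topology

variable {E : Type*} [NormedAddCommGroup E] [NormedSpace ℝ E] {L g : E → ℝ} {M : ℝ}

/-- The Hopf-Lax evolution `Q_t g(x) = inf_w (g (x - t w) + t L(w))` for `t > 0`, as a function of
`(t, x)`. It is extended to `t ≤ 0` by an upper bound `M` of `g`, which keeps the inequality
`hopfLax_add_le` true for all times. -/
noncomputable def hopfLax (L g : E → ℝ) (M : ℝ) (p : ℝ × E) : ℝ :=
  if p.1 ≤ 0 then M else ⨅ w, (g (p.2 - p.1 • w) + p.1 * L w)

theorem bddBelow_hopfLax (hL : ∀ w, 0 ≤ L w) (hg : ∀ x, |g x| ≤ M) {t : ℝ} (ht : 0 ≤ t) (x : E) :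
    BddBelow (Set.range fun w => g (x - t • w) + t * L w) := by
  refine ⟨-M, ?_⟩
  rintro _ ⟨w, rfl⟩
  have := (abs_le.1 (hg (x - t • w))).1
  have := mul_nonneg ht (hL w)
  linarith

theorem hopfLax_of_nonpos {t : ℝ} (ht : t ≤ 0) (x : E) : hopfLax L g M (t, x) = M := if_pos ht

theorem hopfLax_of_pos {t : ℝ} (ht : 0 < t) (x : E) :
    hopfLax L g M (t, x) = ⨅ w, (g (x - t • w) + t * L w) := if_neg ht.not_ge

theorem hopfLax_le (hL : ∀ w, 0 ≤ L w) (hL0 : L 0 = 0) (hg : ∀ x, |g x| ≤ M) {t : ℝ} (ht : 0 < t)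
    (x : E) : hopfLax L g M (t, x) ≤ g x := by
  rw [hopfLax_of_pos ht]
  refine (ciInf_le (bddBelow_hopfLax hL hg ht.le x) 0).trans ?_
  simp [hL0]

theorem abs_hopfLax_le (hL : ∀ w, 0 ≤ L w) (hL0 : L 0 = 0) (hg : ∀ x, |g x| ≤ M) (p : ℝ × E) :
    |hopfLax L g M p| ≤ M := by
  obtain ⟨t, x⟩ := p
  have hM : 0 ≤ M := (abs_nonneg _).trans (hg x)
  rcases le_or_gt t 0 with ht | ht
  · rw [hopfLax_of_nonpos ht, abs_of_nonneg hM]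
  · refine abs_le.2 ⟨?_, (hopfLax_le hL hL0 hg ht x).trans (abs_le.1 (hg x)).2⟩
    rw [hopfLax_of_pos ht]
    refine le_ciInf fun w => ?_
    have := (abs_le.1 (hg (x - t • w))).1
    have := mul_nonneg ht.le (hL w)
    linarith

/-- The Hopf-Lax evolution is a sub-solution of the Hamilton-Jacobi equation, in the integrated form
that needs no differentiability. -/
theorem hopfLax_add_le (hLc : ConvexOn ℝ Set.univ L) (hL : ∀ w, 0 ≤ L w) (hL0 : L 0 = 0)
    (hg : ∀ x, |g x| ≤ M) {s : ℝ} (hs : 0 ≤ s) (p : ℝ × E) (v : E) :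
    hopfLax L g M (p + s • (1, v)) ≤ hopfLax L g M p + s * L v := by
  obtain ⟨t, x⟩ := p
  have hps : (t, x) + s • ((1 : ℝ), v) = (t + s, x + s • v) := by simp
  rw [hps]
  have hsv : 0 ≤ s * L v := mul_nonneg hs (hL v)
  rcases le_or_gt t 0 with ht | ht
  · rw [hopfLax_of_nonpos ht]
    have := (abs_le.1 (abs_hopfLax_le hL hL0 hg (t + s, x + s • v))).2
    linarith
  · have hts : 0 < t + s := by linarith
    rw [hopfLax_of_pos ht, hopfLax_of_pos hts, ← sub_le_iff_le_add]
    refine le_ciInf fun w => ?_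
    rw [sub_le_iff_le_add]
    refine (ciInf_le (bddBelow_hopfLax hL hg hts.le _)
      ((t / (t + s)) • w + (s / (t + s)) • v)).trans ?_
    have h1 : x + s • v - (t + s) • ((t / (t + s)) • w + (s / (t + s)) • v) = x - t • w := by
      rw [smul_add, smul_smul, smul_smul, mul_div_cancel₀ _ hts.ne', mul_div_cancel₀ _ hts.ne']
      abel
    have h2 := hLc.2 (Set.mem_univ w) (Set.mem_univ v) (div_nonneg ht.le hts.le)
      (div_nonneg hs hts.le) (by rw [← add_div, div_self hts.ne'])
    have h3 := mul_le_mul_of_nonneg_left h2 hts.le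
    have h4 : (t + s) * (t / (t + s) * L w + s / (t + s) * L v) = t * L w + s * L v := by
      field_simp
    simp only [smul_eq_mul] at h3
    rw [h1]
    linarith

theorem le_hopfLax (hLc : ConvexOn ℝ Set.univ L) (hL0 : L 0 = 0) {f : E → ℝ}
    (hf : ∀ x y, f x ≤ g y + L (x - y)) {t : ℝ} (ht : 0 < t) (ht1 : t ≤ 1) (x : E) :
    f x ≤ hopfLax L g M (t, x) := by
  rw [hopfLax_of_pos ht]
  refine le_ciInf fun w => (hf x (x - t • w)).trans ?_
  have h := hLc.2 (Set.mem_univ w) (Set.mem_univ 0) ht.le (sub_nonneg.2 ht1) (by ring)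
  rw [smul_zero, add_zero, hL0, smul_zero, add_zero, smul_eq_mul] at h
  rw [sub_sub_cancel]
  linarith

theorem measurable_hopfLax [MeasurableSpace E] [BorelSpace E] [SecondCountableTopology E]
    (hL : ∀ w, 0 ≤ L w) (hg : ∀ x, |g x| ≤ M) (hgc : Continuous g) :
    Measurable (hopfLax L g M) := by
  -- the infimum is upper semicontinuous once the time is replaced by its positive part
  have husc : UpperSemicontinuous fun p : ℝ × E =>
      ⨅ w, (g (p.2 - (max p.1 0) • w) + max p.1 0 * L w) :=
    upperSemicontinuous_ciInf (fun p => bddBelow_hopfLax hL hg (le_max_right _ _) _)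
      fun w => Continuous.upperSemicontinuous (by fun_prop)
  have heq : hopfLax L g M = fun p : ℝ × E => if p.1 ≤ 0 then M else
      ⨅ w, (g (p.2 - (max p.1 0) • w) + max p.1 0 * L w) := by
    ext p
    by_cases hp : p.1 ≤ 0
    · rw [hopfLax, if_pos hp, if_pos hp]
    · rw [hopfLax, if_neg hp, if_neg hp, max_eq_left (not_le.1 hp).le]
  rw [heq]
  exact Measurable.ite (measurableSet_le measurable_fst measurable_const) measurable_const
    husc.measurable

/-- A differentiable function which satisfies the integrated sub-solution inequality satisfies the
Hamilton-Jacobi inequality `∂ₜu + ⟨w, ∇u⟩ ≤ L(w)` for every direction `w`. -/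
theorem fderiv_le_of_add_le {u : ℝ × E → ℝ} {p : ℝ × E} (hu : DifferentiableAt ℝ u p) {w : E}
    (h : ∀ s : ℝ, 0 ≤ s → u (p + s • (1, w)) ≤ u p + s * L w) : fderiv ℝ u p (1, w) ≤ L w := by
  have hd := (hu.hasFDerivAt.hasLineDerivAt (1, w)).tendsto_slope_zero_right
  refine le_of_tendsto hd ?_
  filter_upwards [self_mem_nhdsWithin] with s hs
  have hs0 : 0 < s := hs
  rw [smul_eq_mul]
  rw [inv_mul_le_iff₀ hs0]
  linarith [h s hs0.le]

end HopfLax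

/-! ### Hypercontractivity -/

section Hypercontractivity

open Filter Topology

variable {n : ℕ} {μ : Measure (Rn n)} [IsProbabilityMeasure μ] {a α C : ℝ}

theorem integrable_of_continuous_of_abs_le {X : Type*} [TopologicalSpace X] [MeasurableSpace X]
    [OpensMeasurableSpace X] {ρ : Measure X} [IsFiniteMeasure ρ] {h : X → ℝ} (hc : Continuous h)
    {M : ℝ} (hM : ∀ x, |h x| ≤ M) : Integrable h ρ :=
  Integrable.of_bound hc.measurable.aestronglyMeasurable M (ae_of_all _ hM)

theorem integrable_exp_of_continuous_of_abs_le {h : Rn n → ℝ} (hc : Continuous h) {M : ℝ}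
    (hM : ∀ x, |h x| ≤ M) : Integrable (fun x => Real.exp (h x)) μ :=
  integrable_of_continuous_of_abs_le (by fun_prop) (M := Real.exp M) fun x => by
    rw [Real.abs_exp]; exact Real.exp_le_exp.2 ((abs_le.1 (hM x)).2)

theorem integral_exp_pos_of_continuous_of_abs_le {h : Rn n → ℝ} (hc : Continuous h) {M : ℝ}
    (hM : ∀ x, |h x| ≤ M) : 0 < ∫ x, Real.exp (h x) ∂μ :=
  integral_exp_pos (integrable_exp_of_continuous_of_abs_le hc hM)

/-- The inequality `LSI` for the function `exp (h / 2)`, whose logarithmic gradient is `∇h / 2`. -/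
theorem LSI.integral_exp_le (hLSI : LSI μ a α C) (hC : 0 < C) {h D : Rn n → ℝ}
    (hs : ContDiff ℝ ∞ h) {M : ℝ} (hM : ∀ x, |h x| ≤ M) (hDc : Continuous D) {M' : ℝ}
    (hDM : ∀ x, |D x| ≤ M') (hD0 : ∀ x, 0 ≤ D x)
    (hD : ∀ x, ∑ i, energyH a α (2⁻¹ * partialDeriv h i x) ≤ ENNReal.ofReal (D x)) :
    ∫ x, h x * Real.exp (h x) ∂μ - (∫ x, Real.exp (h x) ∂μ) * Real.log (∫ x, Real.exp (h x) ∂μ) ≤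
      C * ∫ x, D x * Real.exp (h x) ∂μ := by
  have hc : Continuous h := hs.continuous
  set Z := ∫ x, Real.exp (h x) ∂μ with hZ
  have hZpos : 0 < Z := integral_exp_pos_of_continuous_of_abs_le hc hM
  have hexp : Integrable (fun x => Real.exp (h x)) μ := integrable_exp_of_continuous_of_abs_le hc hM
  have hhexp : Integrable (fun x => h x * Real.exp (h x)) μ :=
    hexp.bdd_mul hc.measurable.aestronglyMeasurable (ae_of_all _ hM)
  have hDexp : Integrable (fun x => D x * Real.exp (h x)) μ :=
    hexp.bdd_mul hDc.measurable.aestronglyMeasurable (ae_of_all _ hDM)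
  set f : Rn n → ℝ := fun x => Real.exp (h x / 2) with hf
  have hfs : ContDiff ℝ ∞ f := Real.contDiff_exp.comp (hs.div_const 2)
  have hfsq : ∀ x, f x ^ 2 = Real.exp (h x) := fun x => by
    rw [hf, ← Real.exp_nat_mul]; congr 1; push_cast; ring
  have hf2 : MemLp f 2 μ := by
    rw [memLp_two_iff_integrable_sq hfs.continuous.measurable.aestronglyMeasurable]
    simpa only [hfsq] using hexp
  have hpd : ∀ i x, partialDeriv f i x / f x = 2⁻¹ * partialDeriv h i x := fun i x => by
    have hd : HasFDerivAt h (fderiv ℝ h x) x := (hs.differentiable (by simp) x).hasFDerivAt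
    have hd2 : HasFDerivAt f (Real.exp (h x / 2) • ((2 : ℝ)⁻¹ • fderiv ℝ h x)) x := by
      have := (hd.mul_const (2⁻¹ : ℝ)).exp
      simpa only [hf, div_eq_mul_inv] using this
    have hne : Real.exp (h x / 2) ≠ 0 := (Real.exp_pos _).ne'
    rw [partialDeriv, hd2.fderiv, partialDeriv]
    simp only [hf, smul_apply, smul_eq_mul]
    field_simp
  have hkey := hLSI f hfs hf2
  have hlog : ∀ x, Real.exp (h x) * Real.log (Real.exp (h x) / Z) =
      h x * Real.exp (h x) - Real.log Z * Real.exp (h x) := fun x => by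
    rw [Real.log_div (Real.exp_pos _).ne' hZpos.ne', Real.log_exp]
    ring
  have hint : Integrable (fun x => Real.exp (h x) * Real.log (Real.exp (h x) / Z)) μ := by
    simp_rw [hlog]
    exact hhexp.sub (hexp.const_mul _)
  have hent : ent μ (fun x => f x ^ 2) =
      ENNReal.ofReal (∫ x, h x * Real.exp (h x) ∂μ - Z * Real.log Z) := by
    rw [funext hfsq, ent, ← hZ, if_pos hint]
    simp_rw [hlog]
    rw [integral_sub hhexp (hexp.const_mul _), integral_const_mul, mul_comm Z]
  have hen : ∫⁻ x, energyDensity a α f x ∂μ ≤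
      ENNReal.ofReal (∫ x, D x * Real.exp (h x) ∂μ) := by
    rw [ofReal_integral_eq_lintegral_ofReal hDexp
      (ae_of_all _ fun x => mul_nonneg (hD0 x) (Real.exp_pos _).le)]
    refine lintegral_mono fun x => ?_
    rw [energyDensity, if_neg (Real.exp_pos _).ne']
    simp_rw [hpd, hfsq]
    rw [ENNReal.ofReal_mul (hD0 x)]
    gcongr
    exact hD x
  rw [hent] at hkey
  have hfin := hkey.trans (mul_le_mul_right hen _)
  rw [← ENNReal.ofReal_mul hC.le] at hfin
  refine (ENNReal.ofReal_le_ofReal_iff ?_).1 hfin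
  exact mul_nonneg hC.le
    (integral_nonneg fun x => mul_nonneg (hD0 x) (Real.exp_pos _).le)

/-- For small `k`, `(1/k) log ∫ exp (k h)` is close to `∫ h`. -/
theorem log_integral_exp_le_of_small {h : Rn n → ℝ} (hc : Continuous h) {M : ℝ}
    (hM : ∀ x, |h x| ≤ M) {k : ℝ} (hk : 0 < k) (hkM : k * M ≤ 1) :
    Real.log (∫ x, Real.exp (k * h x) ∂μ) ≤ k * (∫ x, h x ∂μ + k * M ^ 2) := by
  have hkc : Continuous fun x => k * h x := by fun_prop
  have hkb : ∀ x, |k * h x| ≤ k * M := fun x => by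
    rw [abs_mul, abs_of_pos hk]; exact mul_le_mul_of_nonneg_left (hM x) hk.le
  have hi : Integrable h μ := integrable_of_continuous_of_abs_le hc hM
  refine (Real.log_le_sub_one_of_pos (integral_exp_pos_of_continuous_of_abs_le hkc hkb)).trans ?_
  have h1 : ∫ x, Real.exp (k * h x) ∂μ ≤ ∫ x, (1 + k * h x + k ^ 2 * M ^ 2) ∂μ := by
    refine integral_mono (integrable_exp_of_continuous_of_abs_le hkc hkb)
      (((integrable_const _).add (hi.const_mul k)).add (integrable_const _)) fun x => ?_
    have h2 := (abs_le.1 (Real.abs_exp_sub_one_sub_id_le ((hkb x).trans hkM))).2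
    have h3 : (k * h x) ^ 2 ≤ k ^ 2 * M ^ 2 := by
      rw [← mul_pow, ← sq_abs]
      exact pow_le_pow_left₀ (abs_nonneg _) (hkb x) 2
    change Real.exp (k * h x) ≤ 1 + k * h x + k ^ 2 * M ^ 2
    linarith
  have hi' : Integrable (fun x => 1 + k * h x) μ := (integrable_const _).add (hi.const_mul k)
  rw [integral_add hi' (integrable_const _), integral_add (integrable_const _) (hi.const_mul k),
    integral_const_mul] at h1
  simp only [integral_const, probReal_univ, one_smul] at h1
  linarith

/-- Hypercontractivity along a smooth sub-solution `u` of the Hamilton-Jacobi equation: the quantity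
`(1/k) log ∫ exp (k u)`, where `k = 4 r / C` grows linearly in the elapsed time `r`, does not
increase, because `LSI` bounds the entropy that appears in its derivative by the Hamilton-Jacobi
dissipation. At `r = 0` it starts from `∫ u`. -/
theorem LSI.log_integral_exp_le (hLSI : LSI μ a α C) (ha : 0 < a) (hα : α ∈ Set.Icc (1 : ℝ) 2)
    (hC : 0 < C) {u : ℝ × Rn n → ℝ} (hu : ContDiff ℝ ∞ u) {M K : ℝ} (hM : ∀ p, |u p| ≤ M)
    (hK : ∀ p, ‖fderiv ℝ u p‖ ≤ K)
    (hHJ : ∀ p w, fderiv ℝ u p (1, w) ≤ costLn (a * C / 2) α w) {t₀ B : ℝ}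
    (hB : ∀ r, 0 < r → r ≤ 1 → ∫ x, u (t₀ + r, x) ∂μ ≤ B) {R : ℝ} (hR : 0 < R) (hR1 : R ≤ 1) :
    Real.log (∫ x, Real.exp (4 / C * R * u (t₀ + R, x)) ∂μ) ≤ 4 / C * R * B := by
  set κ := 4 / C with hκ
  have hκ0 : 0 < κ := by positivity
  have ha' : 0 < a * C / 2 := by positivity
  have huc : Continuous u := hu.continuous
  have hud : Differentiable ℝ u := hu.differentiable (by simp)
  have hK0 : 0 ≤ K := (norm_nonneg _).trans (hK (0, 0))
  have hM0 : 0 ≤ M := (abs_nonneg _).trans (hM (0, 0))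
  -- `ut` is the time derivative of `u`; taking `w = 0` in the Hamilton-Jacobi inequality shows that
  -- it is nonpositive
  let ut : ℝ × Rn n → ℝ := fun p => fderiv ℝ u p (1, 0)
  have hutc : Continuous ut := (hu.continuous_fderiv (by simp)).clm_apply continuous_const
  have hutK : ∀ p, |ut p| ≤ K := fun p => by
    refine ((fderiv ℝ u p).le_opNorm _).trans ?_
    simpa using hK p
  have hut0 : ∀ p, ut p ≤ 0 := fun p => by
    simpa [costLn_zero ha'] using hHJ p 0
  let h : ℝ → Rn n → ℝ := fun r x => κ * r * u (t₀ + r, x)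
  have hhc : ∀ r, Continuous (h r) := fun r => by fun_prop
  have hhM : ∀ r x, |h r x| ≤ κ * |r| * M := fun r x => by
    rw [abs_mul, abs_mul, abs_of_pos hκ0]
    exact mul_le_mul_of_nonneg_left (hM _) (by positivity)
  let Z : ℝ → ℝ := fun r => ∫ x, Real.exp (h r x) ∂μ
  have hZpos : ∀ r, 0 < Z r := fun r => integral_exp_pos_of_continuous_of_abs_le (hhc r) (hhM r)
  let h' : ℝ → Rn n → ℝ := fun r x => κ * u (t₀ + r, x) + κ * r * ut (t₀ + r, x)
  have hh'c : ∀ r, Continuous (h' r) := fun r => by fun_prop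
  have hderiv : ∀ r x, HasDerivAt (fun s => h s x) (h' r x) r := fun r x => by
    have h1 : HasDerivAt (fun s : ℝ => (t₀ + s, x)) ((1 : ℝ), (0 : Rn n)) r :=
      ((hasDerivAt_id r).const_add t₀).prodMk (hasDerivAt_const r x)
    have h2 : HasDerivAt (fun s => u (t₀ + s, x)) (ut (t₀ + r, x)) r :=
      (hud (t₀ + r, x)).hasFDerivAt.comp_hasDerivAt r h1
    have h3 : HasDerivAt (fun s => κ * s) κ r := by
      simpa using (hasDerivAt_id r).const_mul κ
    exact h3.mul h2
  have hZ' : ∀ r, HasDerivAt Z (∫ x, h' r x * Real.exp (h r x) ∂μ) r := fun r => by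
    refine (hasDerivAt_integral_of_dominated_loc_of_deriv_le (s := Metric.ball r 1)
      (F' := fun s x => h' s x * Real.exp (h s x))
      (bound := fun _ => (κ * M + κ * (|r| + 1) * K) * Real.exp (κ * (|r| + 1) * M))
      (Metric.ball_mem_nhds r one_pos) ?_ ?_ ?_ ?_ (integrable_const _) ?_).2
    · exact Eventually.of_forall fun s =>
        (Real.continuous_exp.comp (hhc s)).measurable.aestronglyMeasurable
    · exact integrable_exp_of_continuous_of_abs_le (hhc r) (hhM r)
    · exact ((hh'c r).mul (Real.continuous_exp.comp (hhc r))).measurable.aestronglyMeasurable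
    · refine ae_of_all _ fun x s hs => ?_
      have hs1 : |s| ≤ |r| + 1 := by
        rw [Metric.mem_ball, Real.dist_eq] at hs
        have := abs_add_le (s - r) r
        rw [sub_add_cancel] at this
        linarith
      rw [norm_mul, Real.norm_eq_abs, Real.norm_eq_abs, Real.abs_exp]
      have h1 : |h' s x| ≤ κ * M + κ * (|r| + 1) * K := by
        refine (abs_add_le _ _).trans (add_le_add ?_ ?_)
        · rw [abs_mul, abs_of_pos hκ0]
          exact mul_le_mul_of_nonneg_left (hM _) hκ0.le
        · rw [abs_mul, abs_mul, abs_of_pos hκ0]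
          gcongr
          exact hutK _
      have h2 : h s x ≤ κ * (|r| + 1) * M := by
        refine (abs_le.1 (hhM s x)).2.trans ?_
        gcongr
      exact mul_le_mul h1 (Real.exp_le_exp.2 h2) (Real.exp_pos _).le (by positivity)
    · exact ae_of_all _ fun x s _ => by
        have := (hderiv s x).exp
        rwa [mul_comm] at this
  -- The left side has the sign of the derivative of `log (Z r) / (κ r)`. The constant `4 / C` in
  -- `κ` is the one for which the two terms with `∫ ut exp h` cancel: `C (κ r / 2) ^ 2 = κ r ^ 2`.
  have hmain : ∀ r, 0 < r → r ≤ 1 →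
      (∫ x, h' r x * Real.exp (h r x) ∂μ) * r - Z r * Real.log (Z r) ≤ 0 := fun r hr hr1 => by
    have hlam : 0 < κ * r / 2 := by positivity
    have hla : κ * r / 2 * (a * C / 2) ≤ a := by
      have : κ * r / 2 * (a * C / 2) = a * r := by rw [hκ]; field_simp; norm_num
      rw [this]
      exact mul_le_of_le_one_right ha.le hr1
    have hsm : ContDiff ℝ ∞ (h r) :=
      contDiff_const.mul (hu.comp (contDiff_const.prodMk contDiff_id))
    have hpd : ∀ i x, partialDeriv (h r) i x =
        κ * r * fderiv ℝ u (t₀ + r, x) (0, EuclideanSpace.single i 1) := fun i x => by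
      have h1 : HasFDerivAt (fun y : Rn n => (t₀ + r, y))
          (ContinuousLinearMap.inr ℝ ℝ (Rn n)) x := by
        exact hasFDerivAt_prodMk_right (t₀ + r) x
      have h2 := ((hud (t₀ + r, x)).hasFDerivAt.comp x h1).const_mul (κ * r)
      have h3 : HasFDerivAt (h r) ((κ * r) • (fderiv ℝ u (t₀ + r, x)).comp
        (ContinuousLinearMap.inr ℝ ℝ (Rn n))) x := h2
      rw [partialDeriv, h3.fderiv]
      simp
    have hLS := hLSI.integral_exp_le hC (h := h r)
      (D := fun x => (κ * r / 2) ^ 2 * (-ut (t₀ + r, x))) hsm (hhM r) (by fun_prop)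
      (M' := (κ * r / 2) ^ 2 * K)
      (fun x => by
        rw [abs_mul, abs_neg, abs_of_nonneg (sq_nonneg _)]
        exact mul_le_mul_of_nonneg_left (hutK _) (sq_nonneg _))
      (fun x => mul_nonneg (sq_nonneg _) (neg_nonneg.2 (hut0 _)))
      (fun x => by
        have := sum_energyH_le ha ha' hα hlam hla
          (fun i => fderiv ℝ u (t₀ + r, x) (0, EuclideanSpace.single i 1))
          (m := -ut (t₀ + r, x)) fun w => by
            have h1 := hHJ (t₀ + r, x) (WithLp.toLp 2 w)
            have h2 : ((1 : ℝ), (WithLp.toLp 2 w : Rn n)) =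
                (1, 0) + ∑ i, w i • ((0 : ℝ), (EuclideanSpace.single i (1 : ℝ) : Rn n)) := by
              refine Prod.ext ?_ ?_
              · simp [Prod.fst_sum]
              · ext j
                simp [Prod.snd_sum, Finset.sum_apply, Pi.single_apply]
            rw [h2, map_add, map_sum] at h1
            simp only [map_smul, smul_eq_mul] at h1
            change ut (t₀ + r, x) + _ ≤ ∑ i, costL (a * C / 2) α (w i) at h1
            linarith
        simp_rw [hpd]
        refine le_of_eq_of_le (Finset.sum_congr rfl fun i _ => ?_) this
        congr 1
        ring)
    have hexp := integrable_exp_of_continuous_of_abs_le (μ := μ) (hhc r) (hhM r)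
    have hhexp : Integrable (fun x => h r x * Real.exp (h r x)) μ :=
      hexp.bdd_mul (hhc r).measurable.aestronglyMeasurable (ae_of_all _ (hhM r))
    have huexp : Integrable (fun x => ut (t₀ + r, x) * Real.exp (h r x)) μ :=
      hexp.bdd_mul (hutc.comp (Continuous.prodMk_right _)).measurable.aestronglyMeasurable
        (ae_of_all _ fun x => hutK _)
    have e1 : (∫ x, h' r x * Real.exp (h r x) ∂μ) * r = ∫ x, h r x * Real.exp (h r x) ∂μ +
        κ * r ^ 2 * ∫ x, ut (t₀ + r, x) * Real.exp (h r x) ∂μ := by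
      rw [← integral_mul_const, ← integral_const_mul, ← integral_add hhexp (huexp.const_mul _)]
      congr 1
      ext x
      simp only [h', h]
      ring
    have e2 : C * ∫ x, (κ * r / 2) ^ 2 * (-ut (t₀ + r, x)) * Real.exp (h r x) ∂μ =
        -(κ * r ^ 2 * ∫ x, ut (t₀ + r, x) * Real.exp (h r x) ∂μ) := by
      rw [← integral_const_mul, ← integral_const_mul, ← integral_neg]
      congr 1
      ext x
      rw [hκ]
      field_simp
      ring
    rw [e2] at hLS
    rw [e1]
    change ∫ x, h r x * Real.exp (h r x) ∂μ - Z r * Real.log (Z r) ≤ _ at hLS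
    linarith
  have hG' : ∀ r, 0 < r → HasDerivAt (fun r => Real.log (Z r) / (κ * r))
      (((∫ x, h' r x * Real.exp (h r x) ∂μ) / Z r * (κ * r) - Real.log (Z r) * κ) / (κ * r) ^ 2)
      r := fun r hr => by
    have h3 : HasDerivAt (fun s => κ * s) κ r := by
      simpa using (hasDerivAt_id r).const_mul κ
    exact ((hZ' r).log (hZpos r).ne').div h3 (by positivity)
  have hanti : AntitoneOn (fun r => Real.log (Z r) / (κ * r)) (Set.Ioc 0 1) := by
    refine antitoneOn_of_deriv_nonpos (convex_Ioc 0 1)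
      (fun r hr => (hG' r hr.1).continuousAt.continuousWithinAt)
      (fun r hr => (hG' r (interior_subset hr).1).differentiableAt.differentiableWithinAt)
      fun r hr => ?_
    have hr' := interior_subset hr
    rw [(hG' r hr'.1).deriv]
    refine div_nonpos_of_nonpos_of_nonneg ?_ (sq_nonneg _)
    have h1 := hmain r hr'.1 hr'.2
    have h2 : (∫ x, h' r x * Real.exp (h r x) ∂μ) / Z r * (κ * r) - Real.log (Z r) * κ =
        κ / Z r * ((∫ x, h' r x * Real.exp (h r x) ∂μ) * r - Z r * Real.log (Z r)) := by
      have := (hZpos r).ne'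
      field_simp
    rw [h2]
    exact mul_nonpos_of_nonneg_of_nonpos (div_nonneg hκ0.le (hZpos r).le) h1
  have hsmall : ∀ᶠ r in 𝓝[>] (0 : ℝ), Real.log (Z R) / (κ * R) ≤ B + κ * r * M ^ 2 := by
    have hev : ∀ᶠ r in 𝓝[>] (0 : ℝ), κ * r * M < 1 := by
      have : Tendsto (fun r : ℝ => κ * r * M) (𝓝[>] 0) (𝓝 (κ * 0 * M)) :=
        (Continuous.tendsto (by fun_prop) 0).mono_left nhdsWithin_le_nhds
      exact this.eventually_lt_const (by simp)
    filter_upwards [hev, Ioc_mem_nhdsGT hR] with r hr1 hr2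
    have hr3 : r ≤ 1 := hr2.2.trans hR1
    have hkr : 0 < κ * r := mul_pos hκ0 hr2.1
    refine (hanti ⟨hr2.1, hr3⟩ ⟨hR, hR1⟩ hr2.2).trans ?_
    change Real.log (Z r) / (κ * r) ≤ _
    rw [div_le_iff₀ hkr]
    have h1 := log_integral_exp_le_of_small (μ := μ) (h := fun x => u (t₀ + r, x))
      (by fun_prop) (fun x => hM _) hkr hr1.le
    have h2 := mul_le_mul_of_nonneg_left (hB r hr2.1 hr3) hkr.le
    change Real.log (Z r) ≤ _ at h1
    linarith
  have hlim : Tendsto (fun r : ℝ => B + κ * r * M ^ 2) (𝓝[>] 0) (𝓝 B) := by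
    have : Tendsto (fun r : ℝ => B + κ * r * M ^ 2) (𝓝[>] 0) (𝓝 (B + κ * 0 * M ^ 2)) :=
      (Continuous.tendsto (by fun_prop) 0).mono_left nhdsWithin_le_nhds
    simpa using this
  have hfin := ge_of_tendsto hlim hsmall
  rw [div_le_iff₀ (mul_pos hκ0 hR)] at hfin
  change Real.log (Z R) ≤ _
  linarith

end Hypercontractivity

/-! ### The dual transport inequality -/

section Transport

open Filter Topology
open scoped BoundedContinuousFunction

variable {n : ℕ} {μ : Measure (Rn n)} [IsProbabilityMeasure μ] {a α C : ℝ}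

/-- The inequality between entropy and log-Laplace transform (one half of the Gibbs variational
principle). -/
theorem integral_mul_le_entropy_add_log {F : Rn n → ℝ} (hF : IsProbDensity μ F)
    (hlog : Integrable (fun x => F x * Real.log (F x)) μ) {h : Rn n → ℝ} (hc : Continuous h)
    {M : ℝ} (hM : ∀ x, |h x| ≤ M) :
    ∫ x, F x * h x ∂μ ≤ ∫ x, F x * Real.log (F x) ∂μ + Real.log (∫ x, Real.exp (h x) ∂μ) := by
  obtain ⟨hFi, hF0, hF1⟩ := hF
  set Z := ∫ x, Real.exp (h x) ∂μ with hZ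
  have hZpos : 0 < Z := integral_exp_pos_of_continuous_of_abs_le hc hM
  have hexp : Integrable (fun x => Real.exp (h x)) μ := integrable_exp_of_continuous_of_abs_le hc hM
  have hFh : Integrable (fun x => F x * h x) μ :=
    hFi.mul_bdd hc.measurable.aestronglyMeasurable (ae_of_all _ hM)
  -- Young's inequality for the conjugate pair `x log x - x`, `exp`
  have young : ∀ x y : ℝ, 0 ≤ x → x * y ≤ x * Real.log x - x + Real.exp y := fun x y hx => by
    rcases hx.eq_or_lt with rfl | hx
    · simpa using (Real.exp_pos y).le
    · have h1 := mul_le_mul_of_nonneg_left (Real.add_one_le_exp (y - Real.log x)) hx.le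
      rw [Real.exp_sub, Real.exp_log hx, mul_div_cancel₀ _ hx.ne'] at h1
      linarith
  have hle : ∫ x, (F x * h x - Real.log Z * F x) ∂μ ≤
      ∫ x, (F x * Real.log (F x) - F x + Real.exp (h x) / Z) ∂μ := by
    refine integral_mono_ae (hFh.sub (hFi.const_mul _))
      ((hlog.sub hFi).add (hexp.div_const Z)) ?_
    filter_upwards [hF0] with x hx
    have := young (F x) (h x - Real.log Z) hx
    rw [Real.exp_sub, Real.exp_log hZpos] at this
    change F x * h x - Real.log Z * F x ≤ F x * Real.log (F x) - F x + Real.exp (h x) / Z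
    linarith
  have hi : Integrable (fun x => F x * Real.log (F x) - F x) μ := hlog.sub hFi
  rw [integral_sub hFh (hFi.const_mul _), integral_add hi (hexp.div_const Z),
    integral_sub hlog hFi, integral_const_mul, integral_div, hF1, ← hZ, div_self hZpos.ne'] at hle
  linarith

/-- The dual transport inequality. It comes from hypercontractivity along the mollified Hopf-Lax
evolution of `-ψ`, which dominates `φ` up to time one. -/
theorem LSI.integral_add_integral_le (hLSI : LSI μ a α C) (ha : 0 < a)
    (hα : α ∈ Set.Icc (1 : ℝ) 2) (hC : 0 < C) {F : Rn n → ℝ} (hF : IsProbDensity μ F)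
    (hlog : Integrable (fun x => F x * Real.log (F x)) μ) (φ ψ : Rn n →ᵇ ℝ)
    (hφψ : ∀ x y, φ x + ψ y ≤ costLn (a * C / 2) α (x - y)) :
    ∫ x, F x * φ x ∂μ + ∫ x, ψ x ∂μ ≤ C / 4 * ∫ x, F x * Real.log (F x) ∂μ := by
  have ha' : 0 < a * C / 2 := by positivity
  set κ := 4 / C with hκ
  have hκ0 : 0 < κ := by positivity
  set L : Rn n → ℝ := costLn (a * C / 2) α with hL
  have hL0 : ∀ w, 0 ≤ L w := costLn_nonneg ha' hα
  have hLz : L 0 = 0 := costLn_zero ha'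
  have hLc : ConvexOn ℝ Set.univ L := convexOn_costLn ha' hα
  set M := max ‖φ‖ ‖ψ‖ with hM
  have hφM : ∀ x, |φ x| ≤ M := fun x => (φ.norm_coe_le_norm x).trans (le_max_left _ _)
  have hgM : ∀ x, |(-ψ) x| ≤ M := fun x => by
    change |-(ψ x)| ≤ M
    rw [abs_neg]; exact (ψ.norm_coe_le_norm x).trans (le_max_right _ _)
  have hφ2 : Continuous fun p : ℝ × Rn n => φ p.2 := by fun_prop
  have hg2 : Continuous fun p : ℝ × Rn n => (-ψ) p.2 := (-ψ).continuous.comp continuous_snd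
  -- Mollification at scale `ε` mixes times in `(t - ε, t + ε)`. The evolution is followed from
  -- `t = ε` to `t = 1 - ε`, so that only the Hopf-Lax values at times in `(0, 1)` enter.
  let ε : ℕ → ℝ := fun m => 1 / ((m : ℝ) + 3)
  have hε0 : ∀ m, 0 < ε m := fun m => by positivity
  have hε1 : ∀ m, 0 < 1 - 2 * ε m := fun m => by
    have : ε m ≤ 1 / 3 := one_div_le_one_div_of_le (by norm_num) (by
      linarith [Nat.cast_nonneg (α := ℝ) m])
    linarith
  have hεlim : Tendsto ε atTop (𝓝 0) := by
    have h1 : Tendsto (fun m : ℕ => (m : ℝ) + 3) atTop atTop :=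
      tendsto_atTop_add_const_right _ _ tendsto_natCast_atTop_atTop
    simp only [ε, one_div]
    exact tendsto_inv_atTop_zero.comp h1
  let η : ℕ → ContDiffBump (0 : ℝ × Rn n) := fun m =>
    ⟨ε m / 2, ε m, half_pos (hε0 m), half_lt_self (hε0 m)⟩
  set v : ℝ × Rn n → ℝ := hopfLax L (-ψ) M with hv
  have hvm : Measurable v := measurable_hopfLax hL0 hgM (-ψ).continuous
  have hvM : ∀ p, |v p| ≤ M := abs_hopfLax_le hL0 hLz hgM
  let ρ : Measure (ℝ × Rn n) := (volume : Measure ℝ).prod volume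
  have hρ : ρ.IsAddHaarMeasure := Measure.prod.instIsAddHaarMeasure _ _
  let φm : ℕ → Rn n → ℝ := fun m x => mollify ρ (η m) (fun p => φ p.2) (0, x)
  let gm : ℕ → Rn n → ℝ := fun m x => mollify ρ (η m) (fun p => (-ψ) p.2) (0, x)
  have hφmc : ∀ m, Continuous (φm m) := fun m =>
    (contDiff_mollify ρ (η m) hφ2.measurable fun p => hφM p.2).continuous.comp
      (Continuous.prodMk_right 0)
  have hgmc : ∀ m, Continuous (gm m) := fun m =>
    (contDiff_mollify ρ (η m) hg2.measurable fun p => hgM p.2).continuous.comp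
      (Continuous.prodMk_right 0)
  have hφmM : ∀ m x, |φm m x| ≤ M := fun m x => abs_mollify_le ρ (η m) (fun p => hφM p.2) _
  have hgmM : ∀ m x, |gm m x| ≤ M := fun m x => abs_mollify_le ρ (η m) (fun p => hgM p.2) _
  have hfst : ∀ m, ∀ q : ℝ × Rn n, ‖q‖ < (η m).rOut → |q.1| < ε m := fun m q hq =>
    (norm_fst_le q).trans_lt hq
  have hstep : ∀ m, κ * (1 - 2 * ε m) * ∫ x, F x * φm m x ∂μ ≤
      ∫ x, F x * Real.log (F x) ∂μ + κ * (1 - 2 * ε m) * ∫ x, gm m x ∂μ := fun m => by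
    set u := mollify ρ (η m) v with hu
    have hus : ContDiff ℝ ∞ u := contDiff_mollify ρ (η m) hvm hvM
    have huM : ∀ p, |u p| ≤ M := abs_mollify_le ρ (η m) hvM
    obtain ⟨K, hK⟩ := exists_norm_fderiv_mollify_le ρ (η m) hvm hvM
    have hHJ : ∀ p w, fderiv ℝ u p (1, w) ≤ L w := fun p w =>
      fderiv_le_of_add_le (hus.differentiable (by simp) p) fun s hs =>
        mollify_le_mollify_add ρ (η m) hvm hvM hvm hvM fun q _ => by
          rw [add_sub_right_comm]
          exact hopfLax_add_le hLc hL0 hLz hgM hs (p - q) w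
    have hlow : ∀ x, φm m x ≤ u (ε m + (1 - 2 * ε m), x) := fun x => by
      have h1 := mollify_le_mollify_add ρ (η m) (p := (0, x))
        (p' := (ε m + (1 - 2 * ε m), x)) (c := 0) hφ2.measurable (fun p => hφM p.2) hvm hvM
        fun q hq => by
          have hq1 := abs_lt.1 (hfst m q hq)
          have h2 := le_hopfLax (M := M) (g := -ψ) hLc hLz (f := φ)
            (fun x y => by
              have := hφψ x y
              change φ x ≤ -(ψ y) + L (x - y)
              linarith)
            (t := ε m + (1 - 2 * ε m) - q.1) (by linarith [hε1 m]) (by linarith) (x - q.2)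
          rw [add_zero]
          exact h2
      rwa [add_zero] at h1
    have hup : ∀ r, 0 < r → ∀ x, u (ε m + r, x) ≤ gm m x := fun r hr x => by
      have h1 := mollify_le_mollify_add ρ (η m) (p := (ε m + r, x))
        (p' := (0, x)) (c := 0) hvm hvM hg2.measurable (fun p => hgM p.2)
        fun q hq => by
          have hq1 := abs_lt.1 (hfst m q hq)
          have h2 := hopfLax_le (M := M) (g := -ψ) hL0 hLz hgM
            (t := ε m + r - q.1) (by linarith) (x - q.2)
          rw [add_zero]
          exact h2
      rwa [add_zero] at h1
    have huc : ∀ t, Continuous fun x => u (t, x) := fun t =>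
      hus.continuous.comp (Continuous.prodMk_right t)
    have hhyp := hLSI.log_integral_exp_le ha hα hC hus huM hK hHJ (t₀ := ε m)
      (B := ∫ x, gm m x ∂μ)
      (fun r hr _ => integral_mono (integrable_of_continuous_of_abs_le (huc _) fun x => huM _)
        (integrable_of_continuous_of_abs_le (hgmc m) (hgmM m)) (hup r hr))
      (hε1 m) (by linarith [hε0 m])
    have hkpos : 0 < κ * (1 - 2 * ε m) := mul_pos hκ0 (hε1 m)
    have hgibbs := integral_mul_le_entropy_add_log hF hlog
      (h := fun x => κ * (1 - 2 * ε m) * u (ε m + (1 - 2 * ε m), x))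
      (continuous_const.mul (huc _)) (M := κ * (1 - 2 * ε m) * M) fun x => by
        rw [abs_mul, abs_of_pos hkpos]
        exact mul_le_mul_of_nonneg_left (huM _) hkpos.le
    have hcomp : κ * (1 - 2 * ε m) * ∫ x, F x * φm m x ∂μ ≤
        ∫ x, F x * (κ * (1 - 2 * ε m) * u (ε m + (1 - 2 * ε m), x)) ∂μ := by
      rw [← integral_const_mul]
      refine integral_mono_ae
        ((hF.1.mul_bdd (hφmc m).measurable.aestronglyMeasurable
          (ae_of_all _ (hφmM m))).const_mul _)
        (hF.1.mul_bdd (c := κ * (1 - 2 * ε m) * M)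
          (continuous_const.mul (huc _)).measurable.aestronglyMeasurable
          (ae_of_all _ fun x => by
            rw [Real.norm_eq_abs, abs_mul, abs_of_pos hkpos]
            exact mul_le_mul_of_nonneg_left (huM _) hkpos.le)) ?_
      filter_upwards [hF.2.1] with x hx
      have := mul_le_mul_of_nonneg_left (hlow x) (mul_nonneg hkpos.le hx)
      linarith
    linarith
  have hlim1 : Tendsto (fun m => ∫ x, F x * φm m x ∂μ) atTop (𝓝 (∫ x, F x * φ x ∂μ)) := by
    refine tendsto_integral_of_dominated_convergence (fun x => ‖F x‖ * M)
      (fun m => hF.1.aestronglyMeasurable.mul (hφmc m).measurable.aestronglyMeasurable)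
      (hF.1.norm.mul_const M) (fun m => ae_of_all _ fun x => ?_) (ae_of_all _ fun x => ?_)
    · rw [norm_mul]
      exact mul_le_mul_of_nonneg_left (hφmM m x) (norm_nonneg _)
    · exact (tendsto_mollify ρ (φ := η) hεlim hφ2 (0, x)).const_mul (F x)
  have hlim2 : Tendsto (fun m => ∫ x, gm m x ∂μ) atTop (𝓝 (∫ x, (-ψ) x ∂μ)) := by
    refine tendsto_integral_of_dominated_convergence (fun _ => M)
      (fun m => (hgmc m).measurable.aestronglyMeasurable)
      (integrable_const M) (fun m => ae_of_all _ (hgmM m)) (ae_of_all _ fun x => ?_)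
    exact tendsto_mollify ρ (φ := η) hεlim hg2 (0, x)
  have hlimk : Tendsto (fun m => κ * (1 - 2 * ε m)) atTop (𝓝 κ) := by
    simpa using ((hεlim.const_mul 2).const_sub 1).const_mul κ
  have hfin := le_of_tendsto_of_tendsto' (hlimk.mul hlim1)
    ((hlimk.mul hlim2).const_add (∫ x, F x * Real.log (F x) ∂μ)) hstep
  have hneg : ∫ x, (-ψ) x ∂μ = -∫ x, ψ x ∂μ := integral_neg _
  rw [hneg] at hfin
  have h4 : κ * (∫ x, F x * φ x ∂μ + ∫ x, ψ x ∂μ) ≤ ∫ x, F x * Real.log (F x) ∂μ := by linarith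
  have h5 : C / 4 * κ = 1 := by rw [hκ]; field_simp
  have h6 := mul_le_mul_of_nonneg_left h4 (by positivity : 0 ≤ C / 4)
  rwa [← mul_assoc, h5, one_mul] at h6

end Transport

end ModifiedLogSobolev

theorem mainTheorem2 (n : ℕ) (μ : MeasureTheory.Measure (ModifiedLogSobolev.Rn n))
    [MeasureTheory.IsProbabilityMeasure μ]
    (a α C : ℝ) (ha : 0 < a) (hα : α ∈ Set.Icc (1 : ℝ) 2) (hC : 0 < C)
    (hLSI : ModifiedLogSobolev.LSI μ a α C) :
    ModifiedLogSobolev.TransportIneq μ (a * C / 2) α (C / 4) := by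
  open ModifiedLogSobolev in
  intro F hF
  have ha' : 0 < a * C / 2 := by positivity
  have hF1 : ∀ x, F x * Real.log (F x / ∫ y, F y ∂μ) = F x * Real.log (F x) := fun x => by
    rw [hF.2.2, div_one]
  by_cases hlog : Integrable (fun x => F x * Real.log (F x)) μ
  swap
  · rw [ent, funext hF1, if_neg hlog, ENNReal.mul_top (by simpa using hC)]
    exact le_top
  rw [ent, funext hF1, if_pos hlog, ← ENNReal.ofReal_mul (by positivity)]
  set ν := μ.withDensity fun x => ENNReal.ofReal (F x) with hν
  have hνp : IsProbabilityMeasure ν := ⟨by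
    rw [hν, withDensity_apply _ MeasurableSet.univ, Measure.restrict_univ,
      ← ofReal_integral_eq_lintegral_ofReal hF.1 hF.2.1, hF.2.2, ENNReal.ofReal_one]⟩
  obtain ⟨π, hπ, hfst, hsnd, hle⟩ := exists_coupling_of_dual_le ν μ
    (fun p => costLn (a * C / 2) α (p.1 - p.2))
    ((continuous_costLn ha' hα).comp (continuous_fst.sub continuous_snd))
    (fun p => costLn_nonneg ha' hα _) (C / 4 * ∫ x, F x * Real.log (F x) ∂μ)
    fun φ ψ hφψ => by
      have h1 : ∫ x, φ x ∂ν = ∫ x, F x * φ x ∂μ := by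
        rw [hν, integral_withDensity_eq_integral_toReal_smul₀ hF.1.aemeasurable.ennreal_ofReal
          (ae_of_all _ fun _ => ENNReal.ofReal_lt_top)]
        refine integral_congr_ae ?_
        filter_upwards [hF.2.1] with x hx
        rw [ENNReal.toReal_ofReal hx, smul_eq_mul]
      rw [h1]
      exact hLSI.integral_add_integral_le ha hα hC hF hlog φ ψ hφψ
  exact (iInf_le_of_le π (iInf_le_of_le hπ (iInf_le_of_le ⟨hfst, hsnd⟩ le_rfl))).trans hle
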